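/- A \emph{quantitative reachability game} $\mathcal G$ consists of a finite set $\Pi$ of players, a finite set $V$ of vertices, a set $E\subseteq V\times V$ of edges such that every vertex has a successor, a partition $(V_i)_{i\in\Pi}$ of $V$ (parts may be empty), and target sets $F_i\subseteq V$ $(i\in\Pi)$. A play is an infinite path $\rho=\rho_0\rho_1\dots$, a history is a nonempty finite path; the length $|h|$ of a history is its number of edges. $\mathrm{Cost}_i(\rho)$ is the least $k$ with $\rho_k\in F_i$, and $+\infty$ if there is none; $\mathrm{Visit}(\rho)$ is the set of players $i$ such that $\rho$ visits $F_i$. In the game $(\mathcal G,v_0)$ with initial vertex $v_0$, a strategy $\sigma_i$ of player $i$ assigns to each history from $v_0$ ending in a vertex $v\in V_i$ a successor of $v$; a profile $\sigma=(\sigma_i)_{i\in\Pi}$ has a unique outcome $\langle\sigma\rangle_{v_0}$, the play from $v_0$ that follows all $\sigma_i$, and its cost profile is $(\mathrm{Cost}_i(\langle\sigma\rangle_{v_0}))_{i\in\Pi}$. Cost profiles are ordered componentwise. The profile $\sigma$ is a \emph{Nash equilibrium} (NE) if no player can lower his cost by a unilateral change of strategy. It is a \emph{subgame perfect equilibrium}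 (SPE) if for every history $hv$ from $v_0$ the profile $h'\mapsto\sigma_i(hh')$ is an NE in the game with initial vertex $v$ and costs $\rho\mapsto\mathrm{Cost}_i(h\rho)$. A play is a \emph{lasso} $h\ell^\omega$ if it has this form with $h\ell$ a history and $\ell$ nonempty. A profile has \emph{memory at most} $N$ if each of its strategies $\sigma_i$ is given by a finite-state machine with at most $N$ states: $\sigma_i(hv)=\alpha_n(\hat\alpha_u(m_0,h),v)$, where $m_0$ is the initial state, $\alpha_u$ the update function (iterated along $h$) and $\alpha_n$ the next-action function. The \emph{extended game} $(\mathcal X,x_0)$ of $(\mathcal G,v_0)$ is the quantitative reachability game with the same players, vertex set $V\times 2^\Pi$, an edge from $(v,I)$ to $(v',I')$ iff $(v,v')\in E$ and $I'=I\cup\{i\mid v'\in F_i\}$, where $(v,I)$ belongs to the owner of $v$, the target set of $i$ is $\{(v,I)\mid i\in I\}$, and $x_0=(v_0,\{i\mid v_0\in F_i\})$. \textbf{Statement.} There is an absolute constant $C$ such that the following two claims hold for every quantitative reachability game $\mathcal G$, every initial vertex $v_0$ and every $y\in(\mathbb N\cup\{+\infty\})^{\Pi}$; here $|\Pi|$ and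 $|V|$ always refer to $\mathcal G$. (1) If there is an NE in $(\mathcal G,v_0)$ with cost profile $\le y$, then there is an NE $\tau$ in $(\mathcal G,v_0)$ such that, with $\rho=\langle\tau\rangle_{v_0}$: $(\mathrm{Cost}_i(\rho))_{i\in\Pi}\le y$; $\rho$ is a lasso $h\ell^\omega$ with $|h\ell|\le(|\Pi|+1)\cdot|V|$; $\mathrm{Cost}_i(\rho)\le|\Pi|\cdot|V|$ for each $i\in\mathrm{Visit}(\rho)$; and $\tau$ has memory at most $C\cdot(|\Pi|+1)\cdot|V|$. (2) If there is an SPE in $(\mathcal X,x_0)$ with cost profile $\le y$, then there is an SPE $\tau$ in $(\mathcal X,x_0)$ such that, with $\rho=\langle\tau\rangle_{x_0}$ and with costs and $\mathrm{Visit}$ taken in $\mathcal X$: $(\mathrm{Cost}_i(\rho))_{i\in\Pi}\le y$; $\rho$ is a lasso $h\ell^\omega$ with $|h\ell|\le(|\Pi|+1)\cdot|V|$; $\mathrm{Cost}_i(\rho)\le|\Pi|\cdot|V|$ for each $i\in\mathrm{Visit}(\rho)$; and $\tau$ has memory at most $C\cdot 2^{|\Pi|}\cdot|\Pi|\cdot|V|^{(|\Pi|+1)\cdot(|\Pi|+|V|)+1}$.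 -/

import Mathlib

universe u w

namespace ReachabilityGames

/-- An arena with players `P` and vertices `V` (finiteness of both is assumed where it is used):
an edge relation without dead ends, and the partition of the vertices among the players,
given by the owner of each vertex. -/
structure Arena (P : Type u) (V : Type w) where
  E : V → V → Prop
  exists_succ : ∀ v, ∃ v', E v v'
  owner : V → P

/-- A game: an arena with one cost function per player. -/
structure Game (P : Type u) (V : Type w) where
  arena : Arena P V
  cost : P → (ℕ → V) → ℕ∞

/-- A strategy, as a map sending the history `h v` (past `h`, current vertex `v`) to a vertex.
Only its values at the histories of the player concerned are relevant, see `IsStrategy`. -/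
abbrev Strategy (V : Type w) := List V → V → V

/-- One strategy per player. -/
abbrev Profile (P : Type u) (V : Type w) := P → Strategy V

namespace Arena

variable {P : Type u} {V : Type w}

/-- Nonempty finite paths of the arena. -/
def IsHistory (A : Arena P V) (l : List V) : Prop :=
  l ≠ [] ∧ List.IsChain A.E l

/-- Histories starting in `v₀`. -/
def IsHistoryFrom (A : Arena P V) (v₀ : V) (l : List V) : Prop :=
  A.IsHistory l ∧ l.head? = some v₀

/-- Infinite paths of the arena. -/
def IsPlay (A : Arena P V) (ρ : ℕ → V) : Prop :=
  ∀ k, A.E (ρ k) (ρ (k + 1))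

/-- `s` is a strategy of player `i` in a game with this arena, initialized in `v₀`: after each
history from `v₀` that ends in a vertex of `i`, it follows an edge. -/
def IsStrategy (A : Arena P V) (v₀ : V) (i : P) (s : Strategy V) : Prop :=
  ∀ (h : List V) (v : V), A.IsHistoryFrom v₀ (h ++ [v]) → A.owner v = i → A.E v (s h v)

/-- `σ` is a strategy profile in a game with this arena, initialized in `v₀`. -/
def IsProfile (A : Arena P V) (v₀ : V) (σ : Profile P V) : Prop :=
  ∀ i, A.IsStrategy v₀ i (σ i)

/-- The first `n` vertices, and the next one, of the play from `v₀` in which all players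
follow `σ`. -/
def outcomeAux (A : Arena P V) (σ : Profile P V) (v₀ : V) : ℕ → List V × V
  | 0 => ([], v₀)
  | n + 1 =>
    let p := outcomeAux A σ v₀ n
    (p.1 ++ [p.2], σ (A.owner p.2) p.1 p.2)

/-- The outcome of `σ` from `v₀`. -/
def outcome (A : Arena P V) (σ : Profile P V) (v₀ : V) : ℕ → V :=
  fun n => (A.outcomeAux σ v₀ n).2

end Arena

section Sequences

variable {V : Type w}

/-- The infinite sequence `h ρ`. -/
def prepend (h : List V) (ρ : ℕ → V) : ℕ → V :=
  fun n => if hn : n < h.length then h[n] else ρ (n - h.length)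

/-- The infinite sequence `l ^ ω`, for a nonempty list `l`. -/
def omegaPower (l : List V) (hl : l ≠ []) : ℕ → V :=
  fun n => l[n % l.length]'(Nat.mod_lt n (List.length_pos_iff.mpr hl))

/-- The length of a history is its number of edges. -/
def historyLength (l : List V) : ℕ := l.length - 1

end Sequences

/-- `ρ` is a lasso `h ℓ^ω` whose length `|h ℓ|` is at most `N`. -/
def Arena.IsLassoOfLengthLE {P : Type u} {V : Type w} (A : Arena P V) (ρ : ℕ → V) (N : ℕ) :
    Prop :=
  ∃ (h l : List V) (hl : l ≠ []),
    A.IsHistory (h ++ l) ∧ ρ = prepend h (omegaPower l hl) ∧ historyLength (h ++ l) ≤ N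

/-- The profile that `σ` induces after the past `h`. -/
def Profile.restrict {P : Type u} {V : Type w} (σ : Profile P V) (h : List V) : Profile P V :=
  fun i h' v => σ i (h ++ h') v

namespace Game

variable {P : Type u} {V : Type w}

/-- The cost profile of the strategy profile `σ` in the game initialized in `v₀`. -/
def costProfile (G : Game P V) (v₀ : V) (σ : Profile P V) : P → ℕ∞ :=
  fun i => G.cost i (G.arena.outcome σ v₀)

open Classical in
/-- `σ` is a Nash equilibrium of the game initialized in `v₀`: no player can lower his cost by a
unilateral change of strategy. -/
def IsNE (G : Game P V) (v₀ : V) (σ : Profile P V) : Prop :=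
  G.arena.IsProfile v₀ σ ∧
    ∀ (i : P) (s : Strategy V), G.arena.IsStrategy v₀ i s →
      G.costProfile v₀ σ i ≤ G.costProfile v₀ (Function.update σ i s) i

/-- The subgame after the past `h`: the cost of `ρ` is the cost of `h ρ`. -/
def subgame (G : Game P V) (h : List V) : Game P V where
  arena := G.arena
  cost := fun i ρ => G.cost i (prepend h ρ)

/-- `σ` is a subgame perfect equilibrium of the game initialized in `v₀`: it induces a Nash
equilibrium in each subgame. -/
def IsSPE (G : Game P V) (v₀ : V) (σ : Profile P V) : Prop :=
  ∀ (h : List V) (v : V), G.arena.IsHistoryFrom v₀ (h ++ [v]) →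
    (G.subgame h).IsNE v (Profile.restrict σ h)

end Game

/-- A quantitative reachability game: an arena with a target set for each player. -/
structure ReachGame (P : Type u) (V : Type w) where
  arena : Arena P V
  target : P → Set V

namespace ReachGame

variable {P : Type u} {V : Type w}

/-- The least index at which `ρ` is in the target set of `i`, and `⊤` if there is none. -/
noncomputable def reachCost (G : ReachGame P V) (i : P) (ρ : ℕ → V) : ℕ∞ :=
  ⨅ (k : ℕ) (_ : ρ k ∈ G.target i), (k : ℕ∞)

/-- The game with the reachability costs. -/
noncomputable def toGame (G : ReachGame P V) : Game P V where
  arena := G.arena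
  cost := G.reachCost

/-- The players who visit their target sets along `ρ`. -/
def visit (G : ReachGame P V) (ρ : ℕ → V) : Set P :=
  {i | ∃ n, ρ n ∈ G.target i}

/-- The players whose target set contains `v`. -/
def visitAt (G : ReachGame P V) (v : V) : Set P :=
  {i | v ∈ G.target i}

/-- The extended game: vertices are equipped with the set of players who have visited their
target sets so far. -/
def extended (G : ReachGame P V) : ReachGame P (V × Set P) where
  arena :=
    { E := fun x x' => G.arena.E x.1 x'.1 ∧ x'.2 = x.2 ∪ G.visitAt x'.1
      exists_succ := fun x =>
        (G.arena.exists_succ x.1).elim fun v' hv' => ⟨(v', x.2 ∪ G.visitAt v'), hv', rfl⟩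
      owner := fun x => G.arena.owner x.1 }
  target := fun i => {x | i ∈ x.2}

/-- The initial vertex of the extended game. -/
def extendedInit (G : ReachGame P V) (v₀ : V) : V × Set P :=
  (v₀, G.visitAt v₀)

end ReachGame

/-- A finite-state machine with `n` memory states: initial state, update function and
next-action function. -/
structure Machine (V : Type w) (n : ℕ) where
  init : Fin n
  update : Fin n → V → Fin n
  next : Fin n → V → V

/-- The strategy defined by a machine. -/
def Machine.strategy {V : Type w} {n : ℕ} (M : Machine V n) : Strategy V :=
  fun h v => M.next (h.foldl M.update M.init) v

/-- In the game initialized in `v₀`, each strategy of the profile `σ` is defined by a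
finite-state machine with at most `N` states. -/
def Arena.HasMemoryLE {P : Type u} {V : Type w} (A : Arena P V) (v₀ : V) (σ : Profile P V)
    (N : ℕ) : Prop :=
  ∀ i : P, ∃ n ≤ N, ∃ M : Machine V n,
    ∀ (h : List V) (v : V), A.IsHistoryFrom v₀ (h ++ [v]) → A.owner v = i →
      σ i h v = M.strategy h v

end ReachabilityGames

/-! Write `n` for the number of players and `m` for the number of vertices. Both claims extract from
the given equilibrium inequalities along plays, and rebuild from them a profile made of finitely
many lassos. Each state of an `Automaton` stands for a play, and a deviation of `i` to `v` switches
to the state `dev v i`. A potential that drops by at most one per step, deviations of `i` included,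
and vanishes on the target set of `i` bounds from below what `i` pays under any deviation
(`le_reachCost_deviation`).

Short outcomes: in the extended game the costs of suffixes only decrease along a play, so each
vertex has an occurrence that is best for all players at once. Always jumping there makes the next
vertex a function of the current one and raises no cost. The visited sets form a chain, so at most
`(n + 1) * m` vertices remain (`exists_short_lasso`).

Nash equilibria: on the outcome, a player still to reach his target set pays at most one more than
the value, in the game of himself against all others, of any vertex he can move to
(`reachCost_shift_le_value_of_isNE`). The short lasso inherits this, and positional punishments that
keep up the value deter deviations.

Subgame perfect equilibria: let `L x` be the supremum, over the histories ending in `x`, of the cost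
of the owner of `x` from there on. Any move out of `x` can be answered by a play that respects all
bounds and costs the owner at least `L x - 1`, or arbitrarily much if `L x` is infinite
(`isValid_speBound`). Such plays can serve as punishments everywhere, but they must be short. So `L`
is enlarged to valid bounds with as few finite values as possible. A wide gap between the finite
bounds is then impossible: punishments costing more than the gap contain a cycle that can be
repeated forever (`exists_pumped_play`), so the bounds above the gap could be made infinite. There
are `m` gaps for each of `n` sizes of the visited set, which bounds all finite values
(`IsMinimalValid.bound`) and hence the punishing lassos. -/

namespace ReachabilityGames

variable {P : Type u} {V : Type w}

/-! ### Sequences and reachability costs -/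

/-- The suffix of `ρ` from index `k` on. -/
def shift (k : ℕ) (ρ : ℕ → V) : ℕ → V := fun n => ρ (n + k)

/-- The list of the first `n` entries of `ρ`. -/
def pref (ρ : ℕ → V) (n : ℕ) : List V := (List.range n).map ρ

theorem shift_apply (k n : ℕ) (ρ : ℕ → V) : shift k ρ n = ρ (n + k) := rfl

@[simp] theorem shift_zero (ρ : ℕ → V) : shift 0 ρ = ρ := rfl

theorem shift_shift (k l : ℕ) (ρ : ℕ → V) : shift k (shift l ρ) = shift (k + l) ρ := by
  funext n
  simp only [shift_apply, add_assoc]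

@[simp] theorem pref_zero (ρ : ℕ → V) : pref ρ 0 = [] := rfl

theorem pref_succ (ρ : ℕ → V) (n : ℕ) : pref ρ (n + 1) = pref ρ n ++ [ρ n] := by
  simp [pref, List.range_succ]

@[simp] theorem length_pref (ρ : ℕ → V) (n : ℕ) : (pref ρ n).length = n := by
  simp [pref]

theorem pref_congr {ρ ρ' : ℕ → V} {n : ℕ} (h : ∀ k < n, ρ k = ρ' k) : pref ρ n = pref ρ' n := by
  simpa [pref] using h

theorem shift_prepend (h : List V) (ρ : ℕ → V) : shift h.length (prepend h ρ) = ρ := by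
  funext n
  simp [shift, prepend]

theorem prepend_of_lt {h : List V} {k : ℕ} (hk : k < h.length) (ρ : ℕ → V) :
    prepend h ρ k = h[k] := by
  simp [prepend, hk]

namespace ReachGame

variable (G : ReachGame P V) (i : P)

theorem le_reachCost_iff {ρ : ℕ → V} {c : ℕ∞} :
    c ≤ G.reachCost i ρ ↔ ∀ k, ρ k ∈ G.target i → c ≤ k := by
  simp [reachCost]

theorem reachCost_le {ρ : ℕ → V} {k : ℕ} (h : ρ k ∈ G.target i) : G.reachCost i ρ ≤ k :=
  (G.le_reachCost_iff i).1 le_rfl k h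

theorem reachCost_le_coe_iff {ρ : ℕ → V} {n : ℕ} :
    G.reachCost i ρ ≤ n ↔ ∃ k ≤ n, ρ k ∈ G.target i := by
  refine ⟨fun h => ?_, fun ⟨k, hk, hρ⟩ => (G.reachCost_le i hρ).trans (by exact_mod_cast hk)⟩
  by_contra! hc
  have : ((n + 1 : ℕ) : ℕ∞) ≤ G.reachCost i ρ := by
    rw [le_reachCost_iff]
    intro k hk
    have : n < k := by
      by_contra! hkn
      exact hc k hkn hk
    exact_mod_cast this
  have := this.trans h
  have : n + 1 ≤ n := by exact_mod_cast this
  omega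

theorem reachCost_eq_zero_iff {ρ : ℕ → V} : G.reachCost i ρ = 0 ↔ ρ 0 ∈ G.target i := by
  have := G.reachCost_le_coe_iff i (ρ := ρ) (n := 0)
  simpa using this

theorem reachCost_eq_top_iff {ρ : ℕ → V} : G.reachCost i ρ = ⊤ ↔ ∀ k, ρ k ∉ G.target i := by
  rw [← top_le_iff, le_reachCost_iff]
  simp

theorem reachCost_le_shift (k : ℕ) (ρ : ℕ → V) :
    G.reachCost i ρ ≤ G.reachCost i (shift k ρ) + k := by
  cases h : G.reachCost i (shift k ρ) with
  | top => simp
  | coe c =>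
    obtain ⟨j, hj, hρ⟩ := (G.reachCost_le_coe_iff i).1 h.le
    refine (G.reachCost_le i (ρ := ρ) (k := j + k) hρ).trans ?_
    exact_mod_cast Nat.add_le_add_right hj k

theorem reachCost_eq_shift {k : ℕ} {ρ : ℕ → V} (h : ∀ j < k, ρ j ∉ G.target i) :
    G.reachCost i ρ = G.reachCost i (shift k ρ) + k := by
  refine le_antisymm (G.reachCost_le_shift i k ρ) ?_
  rw [le_reachCost_iff]
  intro j hj
  have hkj : k ≤ j := by
    by_contra! hlt
    exact h j hlt hj
  have : G.reachCost i (shift k ρ) ≤ (j - k : ℕ) :=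
    G.reachCost_le i (by rwa [shift_apply, Nat.sub_add_cancel hkj])
  refine (add_le_add_left this (k : ℕ∞)).trans ?_
  exact_mod_cast (Nat.sub_add_cancel hkj).le

/-- If `ρ'` meets the target set in the common part, so does `ρ` at the same index. Otherwise `ρ'`
pays `k` on top of its suffix, and `ρ` at most `k` on top of its own. -/
theorem reachCost_mono_of_agree {k : ℕ} {ρ ρ' : ℕ → V} (h : ∀ j < k, ρ j = ρ' j)
    (hc : G.reachCost i (shift k ρ) ≤ G.reachCost i (shift k ρ')) :
    G.reachCost i ρ ≤ G.reachCost i ρ' := by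
  by_cases hk : ∃ j < k, ρ' j ∈ G.target i
  · rw [le_reachCost_iff]
    intro l hl
    obtain ⟨j, hj, hj'⟩ := hk
    by_cases hlk : l < k
    · exact G.reachCost_le i (by rwa [h l hlk])
    · refine (G.reachCost_le i (k := j) (by rwa [h j hj])).trans ?_
      exact_mod_cast (by omega : j ≤ l)
  · push Not at hk
    rw [G.reachCost_eq_shift i hk]
    exact (G.reachCost_le_shift i k ρ).trans (by gcongr)

theorem reachCost_prepend_mono (h : List V) {ρ ρ' : ℕ → V}
    (hc : G.reachCost i ρ ≤ G.reachCost i ρ') :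
    G.reachCost i (prepend h ρ) ≤ G.reachCost i (prepend h ρ') := by
  refine G.reachCost_mono_of_agree i (k := h.length) (fun j hj => ?_) ?_
  · rw [prepend_of_lt hj, prepend_of_lt hj]
  · rwa [shift_prepend, shift_prepend]

theorem reachCost_prepend {h : List V} (hh : ∀ v ∈ h, v ∉ G.target i) (ρ : ℕ → V) :
    G.reachCost i (prepend h ρ) = G.reachCost i ρ + h.length := by
  rw [G.reachCost_eq_shift i (k := h.length), shift_prepend]
  intro j hj
  rw [prepend_of_lt hj]
  exact hh _ (List.getElem_mem hj)

/-- A potential that drops by at most one per step and vanishes on the target set bounds the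
cost from below. -/
theorem potential_le_reachCost {ρ : ℕ → V} {c : ℕ → ℕ∞} (hstep : ∀ k, c k ≤ c (k + 1) + 1)
    (hzero : ∀ k, ρ k ∈ G.target i → c k = 0) : c 0 ≤ G.reachCost i ρ := by
  have key : ∀ k : ℕ, c 0 ≤ c k + k := by
    intro k
    induction k with
    | zero => simp
    | succ k ih =>
      refine ih.trans ((add_le_add_left (hstep k) _).trans (le_of_eq ?_))
      push_cast
      ring
  rw [le_reachCost_iff]
  intro k hk
  simpa [hzero k hk] using key k

end ReachGame

/-! ### Histories, outcomes and subgames -/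

namespace Arena

variable {A : Arena P V}

theorem outcomeAux_fst (σ : Profile P V) (v : V) (n : ℕ) :
    (A.outcomeAux σ v n).1 = pref (A.outcome σ v) n := by
  induction n with
  | zero => rfl
  | succ n ih => rw [pref_succ, ← ih]; rfl

@[simp] theorem outcome_zero (σ : Profile P V) (v : V) : A.outcome σ v 0 = v := rfl

theorem outcome_succ (σ : Profile P V) (v : V) (n : ℕ) :
    A.outcome σ v (n + 1) =
      σ (A.owner (A.outcome σ v n)) (pref (A.outcome σ v) n) (A.outcome σ v n) := by
  rw [← outcomeAux_fst]; rfl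

theorem eq_outcome {σ : Profile P V} {v : V} {ρ : ℕ → V} (h0 : ρ 0 = v)
    (hs : ∀ n, ρ (n + 1) = σ (A.owner (ρ n)) (pref ρ n) (ρ n)) : ρ = A.outcome σ v := by
  funext n
  induction n using Nat.strong_induction_on with
  | _ n ih =>
    cases n with
    | zero => exact h0
    | succ n =>
      rw [hs, outcome_succ, ih n (by omega), pref_congr fun k hk => ih k (by omega)]

theorem IsPlay.shift {ρ : ℕ → V} (h : A.IsPlay ρ) (k : ℕ) : A.IsPlay (shift k ρ) := by
  intro n
  have := h (n + k)
  rwa [add_right_comm] at this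

theorem isHistoryFrom_singleton (v : V) : A.IsHistoryFrom v [v] := by
  simp [IsHistoryFrom, IsHistory]

theorem IsHistoryFrom.snoc {v₀ u v : V} {h : List V} (hh : A.IsHistoryFrom v₀ (h ++ [u]))
    (huv : A.E u v) : A.IsHistoryFrom v₀ (h ++ [u] ++ [v]) := by
  obtain ⟨⟨-, hc⟩, hd⟩ := hh
  refine ⟨⟨by simp, ?_⟩, ?_⟩
  · rw [List.isChain_append]
    refine ⟨hc, by simp, ?_⟩
    simpa using huv
  · rw [List.head?_append, hd]; rfl

theorem IsHistoryFrom.of_snoc {v₀ u v : V} {h : List V}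
    (hh : A.IsHistoryFrom v₀ (h ++ [u] ++ [v])) : A.IsHistoryFrom v₀ (h ++ [u]) ∧ A.E u v := by
  obtain ⟨⟨-, hc⟩, hd⟩ := hh
  rw [List.isChain_append] at hc
  refine ⟨⟨⟨by simp, hc.1⟩, ?_⟩, by simpa using hc.2.2⟩
  rw [List.append_assoc, List.head?_append] at hd
  rw [List.head?_append]
  simpa using hd

theorem IsHistoryFrom.append {v₀ v : V} {h l : List V} (hh : A.IsHistoryFrom v₀ (h ++ [v]))
    (hl : A.IsHistoryFrom v l) : A.IsHistoryFrom v₀ (h ++ l) := by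
  induction l using List.reverseRecOn with
  | nil => exact absurd rfl hl.1.1
  | append_singleton l u ih =>
    rcases l.eq_nil_or_concat with rfl | ⟨l', u', rfl⟩
    · obtain rfl : u = v := by simpa using hl.2
      simpa using hh
    · rw [List.concat_eq_append] at hl ih
      obtain ⟨hl', hE⟩ := hl.of_snoc
      have := ih hl'
      rw [← List.append_assoc] at this
      simpa using this.snoc hE

theorem IsHistoryFrom.append_pref {v₀ v : V} {h : List V} {ρ : ℕ → V}
    (hh : A.IsHistoryFrom v₀ (h ++ [v])) (hρ : A.IsPlay ρ) (h0 : ρ 0 = v) (n : ℕ) :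
    A.IsHistoryFrom v₀ (h ++ pref ρ n ++ [ρ n]) := by
  induction n with
  | zero => simpa [h0] using hh
  | succ n ih =>
    rw [pref_succ, ← List.append_assoc]
    exact ih.snoc (hρ n)

theorem IsProfile.restrict {v₀ v : V} {h : List V} {σ : Profile P V} (hσ : A.IsProfile v₀ σ)
    (hh : A.IsHistoryFrom v₀ (h ++ [v])) : A.IsProfile v (σ.restrict h) := by
  intro i l u hl hu
  refine hσ i (h ++ l) u ?_ hu
  rw [List.append_assoc]
  exact hh.append hl

theorem IsProfile.isPlay_outcome {v : V} {σ : Profile P V} (hσ : A.IsProfile v σ) :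
    A.IsPlay (A.outcome σ v) := by
  have key : ∀ n, A.IsHistoryFrom v (pref (A.outcome σ v) n ++ [A.outcome σ v n]) ∧
      A.E (A.outcome σ v n) (A.outcome σ v (n + 1)) := by
    intro n
    have step : A.IsHistoryFrom v (pref (A.outcome σ v) n ++ [A.outcome σ v n]) →
        A.E (A.outcome σ v n) (A.outcome σ v (n + 1)) := by
      intro hh
      rw [outcome_succ]
      exact hσ _ _ _ hh rfl
    induction n with
    | zero =>
      have := A.isHistoryFrom_singleton v
      exact ⟨this, step this⟩
    | succ n ih =>
      have h1 := ih (fun hh => by rw [outcome_succ]; exact hσ _ _ _ hh rfl)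
      have := h1.1.snoc h1.2
      rw [← pref_succ] at this
      exact ⟨this, step this⟩
  exact fun n => (key n).2

open Classical in
theorem IsProfile.update {v : V} {σ : Profile P V} (hσ : A.IsProfile v σ) {i : P}
    {s : Strategy V} (hs : A.IsStrategy v i s) : A.IsProfile v (Function.update σ i s) := by
  intro j
  by_cases hj : j = i
  · subst hj; simpa using hs
  · rw [Function.update_of_ne hj]; exact hσ j

/-- Suffixes of outcomes are outcomes in subgames. -/
theorem shift_outcome (σ : Profile P V) (h : List V) (v : V) (k : ℕ) :
    shift k (A.outcome (σ.restrict h) v) =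
      A.outcome (σ.restrict (h ++ pref (A.outcome (σ.restrict h) v) k))
        (A.outcome (σ.restrict h) v k) := by
  refine eq_outcome (by simp [shift]) fun n => ?_
  have : pref (A.outcome (σ.restrict h) v) (n + k) =
      pref (A.outcome (σ.restrict h) v) k ++ pref (shift k (A.outcome (σ.restrict h) v)) n := by
    induction n with
    | zero => simp
    | succ n ih => rw [pref_succ, ← List.append_assoc, ← ih, add_right_comm, pref_succ]; rfl
  rw [shift_apply, add_right_comm, outcome_succ, this]
  simp only [Profile.restrict, shift_apply, List.append_assoc]

end Arena

/-! ### Lassos and finite memory -/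

/-- The set of suffixes of `ρ`. -/
def tails (ρ : ℕ → V) : Set (ℕ → V) := Set.range fun k => shift k ρ

theorem self_mem_tails (ρ : ℕ → V) : ρ ∈ tails ρ := ⟨0, rfl⟩

theorem shift_one_mem_tails {ρ π : ℕ → V} (h : π ∈ tails ρ) : shift 1 π ∈ tails ρ := by
  obtain ⟨k, rfl⟩ := h
  exact ⟨1 + k, (shift_shift 1 k ρ).symm⟩

theorem tails_comp {W : Type*} (f : V → W) (ρ : ℕ → V) :
    tails (f ∘ ρ) = (fun π => f ∘ π) '' tails ρ := by
  rw [tails, tails, ← Set.range_comp]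
  rfl

theorem Arena.IsPlay.isHistory_pref {A : Arena P V} {ρ : ℕ → V} (h : A.IsPlay ρ) {n : ℕ}
    (hn : n ≠ 0) : A.IsHistory (pref ρ n) := by
  obtain ⟨n, rfl⟩ := Nat.exists_eq_succ_of_ne_zero hn
  have := (A.isHistoryFrom_singleton (ρ 0)).append_pref (h := []) h rfl n
  rw [Nat.succ_eq_add_one, pref_succ]
  exact this.1

/-- A play with at most `N` suffixes is a lasso. -/
theorem Arena.isLassoOfLengthLE_of_tails {A : Arena P V} {ρ : ℕ → V} (hρ : A.IsPlay ρ) {N : ℕ}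
    (hfin : (tails ρ).Finite) (hN : (tails ρ).ncard ≤ N) : A.IsLassoOfLengthLE ρ N := by
  -- Two of the suffixes at `0, …, N` coincide. The resulting lasso has `q ≤ N` vertices, so `q - 1`
  -- edges.
  obtain ⟨p, q, hpq, hqN, heq⟩ : ∃ p q, p < q ∧ q ≤ N ∧ shift p ρ = shift q ρ := by
    obtain ⟨a, ha, b, hb, hne, hab⟩ := Set.exists_ne_map_eq_of_ncard_lt_of_maps_to
      (s := (Finset.range (N + 1) : Set ℕ)) (t := tails ρ) (f := fun k => shift k ρ)
      (by rw [Set.ncard_coe_finset, Finset.card_range]; omega)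
      (fun k _ => Set.mem_range_self k) hfin
    simp only [Finset.coe_range, Set.mem_Iio] at ha hb
    rcases lt_or_gt_of_ne hne with h | h
    · exact ⟨a, b, h, by omega, hab⟩
    · exact ⟨b, a, h, by omega, hab.symm⟩
  have hper : Function.Periodic (shift p ρ) (q - p) := by
    intro n
    have := congrFun heq n
    simp only [shift_apply] at this ⊢
    rw [this]
    congr 1
    omega
  have happ : pref ρ p ++ pref (shift p ρ) (q - p) = pref ρ q := by
    obtain ⟨d, rfl⟩ := Nat.exists_eq_add_of_lt hpq
    rw [show p + d + 1 - p = d + 1 by omega, add_assoc]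
    simp [pref, List.range_add, shift, add_comm, Function.comp_def]
  refine ⟨pref ρ p, pref (shift p ρ) (q - p), ?_, ?_, ?_, ?_⟩
  · rw [← List.length_pos_iff, length_pref]; omega
  · rw [happ]
    exact hρ.isHistory_pref (by omega)
  · funext n
    by_cases hn : n < p
    · rw [prepend_of_lt (by simpa using hn)]
      simp [pref]
    · have hmod := hper.map_mod_nat (n - p)
      simp only [shift_apply] at hmod
      simp only [prepend, hn, dite_false, omegaPower, pref, List.getElem_map,
        List.getElem_range, List.length_map, List.length_range, shift_apply]
      rw [hmod]
      congr 1
      omega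
  · rw [happ, historyLength, length_pref]
    omega

/-- Strategies computed with a finite set of memory states. -/
theorem Arena.hasMemoryLE_of_fintype (A : Arena P V) (v₀ : V) {S : Type*} [Fintype S] (s₀ : S)
    (upd : S → V → S) (nxt : S → V → V) {N : ℕ} (hN : Fintype.card S ≤ N) :
    A.HasMemoryLE v₀ (fun _ h v => nxt (h.foldl upd s₀) v) N := by
  intro i
  let e := Fintype.equivFin S
  refine ⟨Fintype.card S, hN, ⟨e s₀, fun s v => e (upd (e.symm s) v), fun s v => nxt (e.symm s) v⟩,
    fun h v _ _ => ?_⟩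
  have : ∀ (h : List V) (s : S),
      h.foldl (fun s v => e (upd (e.symm s) v)) (e s) = e (h.foldl upd s) := by
    intro h
    induction h with
    | nil => intro s; rfl
    | cons a h ih => intro s; simp [ih]
  simp [Machine.strategy, this]

/-! ### Automata of plays and the potential bound on deviations -/

/-- A finite description of a family of plays: each state `q` stands for the play through the
vertices of `q`, `step q`, `step (step q)` and so on; after a deviation of `i` to `v`, the play
continues with the state `dev v i`. -/
structure Automaton (A : Arena P V) (Q : Type*) where
  vert : Q → V
  step : Q → Q
  dev : V → P → Q
  edge : ∀ q, A.E (vert q) (vert (step q))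
  vert_dev : ∀ q v, A.E (vert q) v → vert (dev v (A.owner (vert q))) = v

namespace Automaton

variable {A : Arena P V} {Q : Type*} (M : Automaton A Q)

open Classical in
/-- The state after `q` when the play moves to `v`. -/
noncomputable def next (q : Q) (v : V) : Q :=
  if v = M.vert (M.step q) then M.step q else M.dev v (A.owner (M.vert q))

/-- The play that a state stands for. -/
def play (q : Q) : ℕ → V := fun k => M.vert (M.step^[k] q)

theorem next_step (q : Q) : M.next q (M.vert (M.step q)) = M.step q := by
  simp [next]

theorem vert_next {q : Q} {v : V} (h : A.E (M.vert q) v) : M.vert (M.next q v) = v := by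
  unfold next
  split_ifs with hv
  · exact hv.symm
  · exact M.vert_dev q v h

/-- The memory update: `none` is the memory before the first vertex. -/
noncomputable def read (q₀ : Q) : Option Q → V → Option Q
  | none, _ => some q₀
  | some q, v => some (M.next q v)

/-- The state reached after reading a history. -/
noncomputable def state (q₀ : Q) (h : List V) : Q :=
  -- The default is used for the empty list only, since reading a vertex always yields a `some`.
  (h.foldl (M.read q₀) none).getD q₀

/-- The profile in which all players follow the plays of the automaton. -/
noncomputable def profile (q₀ : Q) : Profile P V :=
  fun _ h v => M.vert (M.step (((M.read q₀) (h.foldl (M.read q₀) none) v).getD q₀))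

theorem profile_apply (q₀ : Q) (i : P) (h : List V) (v : V) :
    M.profile q₀ i h v = M.vert (M.step (M.state q₀ (h ++ [v]))) := by
  simp [profile, state]

theorem hasMemoryLE_profile [Fintype Q] (v₀ : V) (q₀ : Q) {N : ℕ}
    (hN : Fintype.card Q + 1 ≤ N) : A.HasMemoryLE v₀ (M.profile q₀) N :=
  A.hasMemoryLE_of_fintype v₀ (S := Option Q) none (M.read q₀)
    (fun s v => M.vert (M.step ((M.read q₀ s v).getD q₀))) (by simpa using hN)

theorem state_singleton (q₀ : Q) (v : V) : M.state q₀ [v] = q₀ := rfl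

theorem state_snoc (q₀ : Q) (h : List V) (u v : V) :
    M.state q₀ (h ++ [u] ++ [v]) = M.next (M.state q₀ (h ++ [u])) v := by
  have : ∃ q, (h ++ [u]).foldl (M.read q₀) none = some q := by
    rw [List.foldl_append]
    cases h.foldl (M.read q₀) none with
    | none => exact ⟨_, rfl⟩
    | some q => exact ⟨_, rfl⟩
  obtain ⟨q, hq⟩ := this
  simp only [state]
  rw [List.foldl_append, hq]
  rfl

theorem vert_state {q₀ : Q} {h : List V} {v : V}
    (hh : A.IsHistoryFrom (M.vert q₀) (h ++ [v])) : M.vert (M.state q₀ (h ++ [v])) = v := by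
  induction h using List.reverseRecOn generalizing v with
  | nil =>
    have : v = M.vert q₀ := by simpa using hh.2
    exact this.symm
  | append_singleton h u ih =>
    obtain ⟨hu, huv⟩ := hh.of_snoc
    rw [state_snoc]
    exact M.vert_next (by rwa [ih hu])

theorem isProfile_profile (q₀ : Q) : A.IsProfile (M.vert q₀) (M.profile q₀) := by
  intro i h v hh _
  have := M.edge (M.state q₀ (h ++ [v]))
  rw [M.vert_state hh] at this
  rwa [profile_apply]

/-- The run of the automaton along a play that starts after the past `h`. -/
noncomputable def run (q₀ : Q) (h : List V) (ρ : ℕ → V) (k : ℕ) : Q :=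
  M.state q₀ (h ++ pref ρ k ++ [ρ k])

section

variable {M} {q₀ : Q} {h : List V} {ρ : ℕ → V}

theorem run_zero : M.run q₀ h ρ 0 = M.state q₀ (h ++ [ρ 0]) := by
  simp [run]

theorem run_succ (k : ℕ) : M.run q₀ h ρ (k + 1) = M.next (M.run q₀ h ρ k) (ρ (k + 1)) := by
  rw [run, run, pref_succ, ← List.append_assoc, state_snoc]

theorem vert_run (hh : A.IsHistoryFrom (M.vert q₀) (h ++ [ρ 0])) (hρ : A.IsPlay ρ) (k : ℕ) :
    M.vert (M.run q₀ h ρ k) = ρ k :=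
  M.vert_state (hh.append_pref hρ rfl k)

end

theorem outcome_restrict_profile {q₀ : Q} {h : List V} {v : V}
    (hh : A.IsHistoryFrom (M.vert q₀) (h ++ [v])) :
    A.outcome ((M.profile q₀).restrict h) v = M.play (M.state q₀ (h ++ [v])) := by
  have hρ := ((M.isProfile_profile q₀).restrict hh).isPlay_outcome
  set ρ := A.outcome ((M.profile q₀).restrict h) v with hdef
  have h0 : ρ 0 = v := rfl
  have hs : ∀ k, ρ (k + 1) = M.vert (M.step (M.run q₀ h ρ k)) := by
    intro k
    rw [hdef, Arena.outcome_succ, Profile.restrict, profile_apply]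
    rfl
  have hrun : ∀ k, M.run q₀ h ρ k = M.step^[k] (M.state q₀ (h ++ [v])) := by
    intro k
    induction k with
    | zero => rw [run_zero, h0]; rfl
    | succ k ih => rw [run_succ, hs, next_step, Function.iterate_succ_apply', ih]
  funext k
  rw [← vert_run (M := M) (q₀ := q₀) (h := h) (ρ := ρ) (by rwa [h0]) hρ k, hrun]
  rfl

theorem outcome_profile (q₀ : Q) : A.outcome (M.profile q₀) (M.vert q₀) = M.play q₀ := by
  exact M.outcome_restrict_profile (q₀ := q₀) (h := []) (v := M.vert q₀)
    (A.isHistoryFrom_singleton _)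

open Classical in
/-- A potential `c` of player `i` on a set `S` of states that is closed under his deviations
bounds his cost from below whenever the other players follow the automaton. -/
theorem le_reachCost_deviation (G : ReachGame P V) (hA : G.arena = A) {q₀ : Q} {h : List V}
    {v : V} (hh : A.IsHistoryFrom (M.vert q₀) (h ++ [v])) (i : P) {S : Set Q} {c : Q → ℕ∞}
    (hS : M.state q₀ (h ++ [v]) ∈ S)
    (hstep : ∀ q ∈ S, M.step q ∈ S ∧ c q ≤ c (M.step q) + 1)
    (hdev : ∀ q ∈ S, A.owner (M.vert q) = i → ∀ u, A.E (M.vert q) u →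
      M.dev u i ∈ S ∧ c q ≤ c (M.dev u i) + 1)
    (hzero : ∀ q ∈ S, M.vert q ∈ G.target i → c q = 0)
    {s : Strategy V} (hs : A.IsStrategy v i s) :
    c (M.state q₀ (h ++ [v])) ≤
      G.reachCost i (A.outcome (Function.update ((M.profile q₀).restrict h) i s) v) := by
  subst hA
  have hρ := (((M.isProfile_profile q₀).restrict hh).update hs).isPlay_outcome
  set ρ := G.arena.outcome (Function.update ((M.profile q₀).restrict h) i s) v with hdef
  have h0 : ρ 0 = v := rfl
  have hvert : ∀ k, M.vert (M.run q₀ h ρ k) = ρ k := vert_run (by rwa [h0]) hρ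
  have key : ∀ k, M.run q₀ h ρ k ∈ S →
      M.run q₀ h ρ (k + 1) ∈ S ∧ c (M.run q₀ h ρ k) ≤ c (M.run q₀ h ρ (k + 1)) + 1 := by
    intro k hk
    rw [run_succ]
    by_cases hn : ρ (k + 1) = M.vert (M.step (M.run q₀ h ρ k))
    · rw [hn, next_step]
      exact hstep _ hk
    -- A step that is not the prescribed one was taken by `i`, as all others follow the automaton.
    · have hown : G.arena.owner (ρ k) = i := by
        by_contra hne
        apply hn
        rw [hdef, Arena.outcome_succ, ← hdef, Function.update_of_ne hne, Profile.restrict,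
          profile_apply]
        rfl
      have hE : G.arena.E (M.vert (M.run q₀ h ρ k)) (ρ (k + 1)) := by
        rw [hvert]; exact hρ k
      rw [next, if_neg hn, hvert, hown]
      exact hdev _ hk (by rw [hvert, hown]) _ hE
  have hmem : ∀ k, M.run q₀ h ρ k ∈ S := by
    intro k
    induction k with
    | zero => rwa [run_zero, h0]
    | succ k ih => exact (key k ih).1
  have := G.potential_le_reachCost i (ρ := ρ) (c := fun k => c (M.run q₀ h ρ k))
    (fun k => (key k (hmem k)).2) (fun k hk => hzero _ (hmem k) (by rwa [hvert]))
  simpa [run_zero, h0] using this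

end Automaton

/-! ### The extended game and short lassos -/

namespace ReachGame

variable (G : ReachGame P V)

theorem extended_edge_subset {x x' : V × Set P} (h : G.extended.arena.E x x') : x.2 ⊆ x'.2 := by
  rw [h.2]; exact Set.subset_union_left

section

variable {G} {ρ : ℕ → V × Set P}

theorem snd_mono_of_isPlay (hρ : G.extended.arena.IsPlay ρ) : Monotone fun k => (ρ k).2 :=
  monotone_nat_of_le_succ fun k => G.extended_edge_subset (hρ k)

/-- Target sets of the extended game are never left, so starting later cannot delay the visit. -/
theorem reachCost_shift_antitone (hρ : G.extended.arena.IsPlay ρ) :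
    Antitone fun k i => G.extended.reachCost i (shift k ρ) := by
  intro j k hjk i
  change G.extended.reachCost i (shift k ρ) ≤ G.extended.reachCost i (shift j ρ)
  rw [le_reachCost_iff]
  intro l hl
  exact G.extended.reachCost_le i (snd_mono_of_isPlay hρ (by omega : l + j ≤ l + k) hl)

theorem notMem_of_lt_reachCost {i : P} {k : ℕ} (h : (k : ℕ∞) < G.extended.reachCost i ρ) :
    i ∉ (ρ k).2 := fun hk => absurd (G.extended.reachCost_le i hk) (not_le.2 h)

/-- Along a play, the visited sets form a chain, so they are determined by their sizes. -/
theorem eq_of_ncard_eq [Finite P] (hρ : G.extended.arena.IsPlay ρ) {j k : ℕ}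
    (h1 : (ρ j).1 = (ρ k).1)
    (h2 : (ρ j).2.ncard = (ρ k).2.ncard) : ρ j = ρ k := by
  refine Prod.ext h1 ?_
  rcases le_total j k with hjk | hjk
  · exact Set.eq_of_subset_of_ncard_le (snd_mono_of_isPlay hρ hjk) h2.ge (Set.toFinite _)
  · exact (Set.eq_of_subset_of_ncard_le (snd_mono_of_isPlay hρ hjk) h2.le (Set.toFinite _)).symm

/-- Each vertex of a play has an occurrence with the least costs. -/
theorem exists_least_occurrence [Finite P] (hρ : G.extended.arena.IsPlay ρ)
    (k : ℕ) : ∃ j, ρ j = ρ k ∧ ∀ l, ρ l = ρ k →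
    ∀ i, G.extended.reachCost i (shift j ρ) ≤ G.extended.reachCost i (shift l ρ) := by
  let c : ℕ → P → ℕ∞ := fun k i => G.extended.reachCost i (shift k ρ)
  have hwf : WellFounded ((· < ·) : (P → ℕ∞) → (P → ℕ∞) → Prop) := wellFounded_lt
  -- The cost vectors of the occurrences are pairwise comparable, so a minimal one is the least.
  obtain ⟨j, hj, hmin⟩ := (InvImage.wf c hwf).has_min {j | ρ j = ρ k} ⟨k, rfl⟩
  refine ⟨j, hj, fun l hl => ?_⟩
  change c j ≤ c l
  rcases le_total j l with hjl | hlj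
  · have hle : c l ≤ c j := reachCost_shift_antitone hρ hjl
    have hn : ¬ c l < c j := hmin l hl
    by_contra hc
    exact hn (lt_of_le_not_ge hle hc)
  · exact reachCost_shift_antitone hρ hlj

end

theorem ncard_lt_card_of_notMem [Fintype P] {s : Set P} {i : P} (hi : i ∉ s) :
    s.ncard < Fintype.card P := by
  rw [← Nat.card_eq_fintype_card, ← Set.ncard_univ]
  exact Set.ncard_lt_ncard ⟨Set.subset_univ _, fun h => hi (h (Set.mem_univ i))⟩ (Set.toFinite _)

/-- Every play of the extended game can be replaced by a lasso with few vertices, all of whose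
suffixes are at least as good for all players as a suffix of the given play with the same first
vertex. -/
theorem exists_short_lasso [Fintype P] [Fintype V] {ρ : ℕ → V × Set P}
    (hρ : G.extended.arena.IsPlay ρ) :
    ∃ π : ℕ → V × Set P, G.extended.arena.IsPlay π ∧ π 0 = ρ 0 ∧
      (∀ i, G.extended.reachCost i π ≤ G.extended.reachCost i ρ) ∧
      (∀ k, ∃ j, π k = ρ j ∧
        ∀ i, G.extended.reachCost i (shift k π) ≤ G.extended.reachCost i (shift j ρ)) ∧
      (tails π).Finite ∧ (tails π).ncard ≤ (Fintype.card P + 1) * Fintype.card V ∧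
      ∀ i, G.extended.reachCost i π ≠ ⊤ →
        G.extended.reachCost i π ≤ (Fintype.card P * Fintype.card V : ℕ) := by
  classical
  have hex : ∀ x : V × Set P, ∃ j, ∀ k, ρ k = x → ρ j = x ∧ ∀ l, ρ l = x →
      ∀ i, G.extended.reachCost i (shift j ρ) ≤ G.extended.reachCost i (shift l ρ) := by
    intro x
    by_cases hx : ∃ k, ρ k = x
    · obtain ⟨k, rfl⟩ := hx
      obtain ⟨j, hj⟩ := exists_least_occurrence hρ k
      exact ⟨j, fun _ _ => hj⟩
    · exact ⟨0, fun k hk => absurd ⟨k, hk⟩ hx⟩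
  choose pos hpos using hex
  have hval : ∀ k, ρ (pos (ρ k)) = ρ k := fun k => (hpos _ k rfl).1
  have hmin : ∀ k i, G.extended.reachCost i (shift (pos (ρ k)) ρ) ≤
      G.extended.reachCost i (shift k ρ) := fun k i => (hpos _ k rfl).2 k rfl i
  -- Advance one step in `ρ`, then jump to the best occurrence of the vertex reached. Thus each
  -- vertex of `π` determines the next one.
  let J : ℕ → ℕ := fun k => (fun j => pos (ρ (j + 1)))^[k] (pos (ρ 0))
  have hJ0 : J 0 = pos (ρ 0) := rfl
  have hJs : ∀ k, J (k + 1) = pos (ρ (J k + 1)) := fun k =>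
    Function.iterate_succ_apply' _ _ _
  let π : ℕ → V × Set P := fun k => ρ (J k)
  have hJpos : ∀ k, J k = pos (π k) := by
    intro k
    cases k with
    | zero => change J 0 = pos (ρ (J 0)); rw [hJ0, hval]
    | succ k => change J (k + 1) = pos (ρ (J (k + 1))); rw [hJs, hval]
  have hπs : ∀ k, π (k + 1) = ρ (pos (π k) + 1) := by
    intro k
    rw [← hJpos]
    change ρ (J (k + 1)) = _
    rw [hJs, hval]
  have hπ : G.extended.arena.IsPlay π := by
    intro k
    rw [hπs, ← hJpos]
    exact hρ (J k)
  have hπ0 : π 0 = ρ 0 := hval 0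
  have hdet : ∀ a b, π a = π b → shift a π = shift b π := by
    intro a b hab
    funext n
    induction n with
    | zero => simpa [shift] using hab
    | succ n ih =>
      simp only [shift_apply, add_right_comm n 1] at ih ⊢
      rw [hπs, hπs, ih]
  -- Induction on the cost along `ρ`: before the visit, a step lowers it by one, and the jump after
  -- the step does not raise it.
  have hcost : ∀ i k, G.extended.reachCost i (shift k π) ≤
      G.extended.reachCost i (shift (J k) ρ) := by
    intro i k
    cases hc : G.extended.reachCost i (shift (J k) ρ) with
    | top => exact le_top
    | coe c =>
      replace hc := hc.le
      induction c generalizing k with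
      | zero =>
        obtain ⟨j, hj, hm⟩ := (G.extended.reachCost_le_coe_iff i).1 hc
        obtain rfl : j = 0 := by omega
        refine (G.extended.reachCost_le_coe_iff i).2 ⟨0, le_rfl, ?_⟩
        simpa [shift, π] using hm
      | succ c ih =>
        by_cases h0 : π k ∈ G.extended.target i
        · exact (G.extended.reachCost_le_coe_iff i).2 ⟨0, by omega, by simpa [shift] using h0⟩
        · have h1 : G.extended.reachCost i (shift (J k + 1) ρ) ≤ c := by
            obtain ⟨j, hj, hm⟩ := (G.extended.reachCost_le_coe_iff i).1 hc
            refine (G.extended.reachCost_le_coe_iff i).2 ?_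
            cases j with
            | zero => exact absurd (by simpa [shift] using hm) h0
            | succ j =>
              refine ⟨j, by omega, ?_⟩
              rw [shift_apply] at hm ⊢
              rwa [← add_assoc, add_right_comm]
          have h2 := ih (k + 1) (by
            rw [hJs]
            exact (hmin _ i).trans h1)
          have h3 := G.extended.reachCost_le_shift i 1 (shift k π)
          rw [shift_shift, add_comm 1 k] at h3
          refine h3.trans ((add_le_add_left h2 _).trans ?_)
          norm_cast
  have hcard : ∀ s : Set P, s.ncard ≤ Fintype.card P := fun s => by
    rw [← Nat.card_eq_fintype_card, ← Set.ncard_univ]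
    exact Set.ncard_le_ncard (Set.subset_univ s) (Set.toFinite _)
  refine ⟨π, hπ, hπ0, fun i => ?_, fun k => ⟨J k, rfl, fun i => hcost i k⟩, ?_⟩
  · exact (hcost i 0).trans (by rw [hJ0]; exact hmin 0 i)
  let f : (ℕ → V × Set P) → Fin (Fintype.card P + 1) × V := fun τ =>
    (⟨(τ 0).2.ncard, Nat.lt_succ_of_le (hcard _)⟩, (τ 0).1)
  have hinj : Set.InjOn f (tails π) := by
    rintro _ ⟨a, rfl⟩ _ ⟨b, rfl⟩ hab
    simp only [f, shift_apply, zero_add, Prod.mk.injEq, Fin.mk.injEq] at hab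
    exact hdet a b (eq_of_ncard_eq hπ hab.2 hab.1)
  refine ⟨Set.Finite.of_injOn (Set.mapsTo_univ f _) hinj Set.finite_univ, ?_, ?_⟩
  · have := Set.ncard_le_ncard_of_injOn f (t := Set.univ) (fun a _ => Set.mem_univ _) hinj
    rwa [Set.ncard_univ, Nat.card_eq_fintype_card, Fintype.card_prod, Fintype.card_fin] at this
  · intro i hi
    obtain ⟨c, hc⟩ := ENat.ne_top_iff_exists.1 hi
    rw [← hc]
    have hnot : ∀ k < c, i ∉ (π k).2 := fun k hk =>
      notMem_of_lt_reachCost (by rw [← hc]; exact_mod_cast hk)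
    have hlt : ∀ k < c, (π k).2.ncard < Fintype.card P := fun k hk =>
      ncard_lt_card_of_notMem (hnot k hk)
    let g : Fin c → Fin (Fintype.card P) × V := fun k =>
      (⟨(π k).2.ncard, hlt k k.2⟩, (π k).1)
    -- A repetition of a vertex at `a < b < c` would copy the visit at `c` to the earlier index `c -
    -- b + a`. So before the visit the vertices are distinct, with visited sets of fewer than `n`
    -- players.
    have hlt' : ∀ a b : ℕ, a < b → b < c → π a ≠ π b := by
      intro a b hab hb heq
      obtain ⟨j, hj, hm⟩ := (G.extended.reachCost_le_coe_iff i (n := c)).1 hc.ge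
      have hjc : j = c := by
        by_contra hne
        exact hnot j (by omega) hm
      subst hjc
      have h1 := congrFun (hdet a b heq) (j - b)
      simp only [shift_apply, Nat.sub_add_cancel hb.le] at h1
      exact hnot (j - b + a) (by omega) (by rw [h1]; exact hm)
    have hg : Function.Injective g := by
      intro a b hab
      simp only [g, Prod.mk.injEq, Fin.mk.injEq] at hab
      have := eq_of_ncard_eq hπ hab.2 hab.1
      by_contra hne
      rcases lt_or_gt_of_ne (fun h => hne (Fin.ext h) : (a : ℕ) ≠ b) with h | h
      · exact hlt' a b h b.2 this
      · exact hlt' b a h a.2 this.symm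
    have := Fintype.card_le_of_injective g hg
    rw [Fintype.card_fin, Fintype.card_prod, Fintype.card_fin] at this
    exact_mod_cast this

end ReachGame

/-! ### Attractors, values and deviations from Nash equilibria -/

namespace ReachGame

variable (G : ReachGame P V) (i : P)

/-- The vertices from which player `i` can force a visit to his target set within `n` steps. -/
def attr : ℕ → Set V
  | 0 => G.target i
  | n + 1 => {v | v ∈ G.target i ∨
      (G.arena.owner v = i ∧ ∃ v', G.arena.E v v' ∧ v' ∈ attr n) ∨
      (G.arena.owner v ≠ i ∧ ∀ v', G.arena.E v v' → v' ∈ attr n)}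

/-- The least number of steps within which player `i` can force a visit to his target set. -/
noncomputable def value (v : V) : ℕ∞ := ⨅ (n : ℕ) (_ : v ∈ G.attr i n), (n : ℕ∞)

theorem attr_mono : Monotone (G.attr i) := by
  refine monotone_nat_of_le_succ fun n => ?_
  induction n with
  | zero => exact fun v hv => Or.inl hv
  | succ n ih =>
    rintro v (hv | ⟨ho, v', hE, hv'⟩ | ⟨ho, hv⟩)
    · exact Or.inl hv
    · exact Or.inr (Or.inl ⟨ho, v', hE, ih hv'⟩)
    · exact Or.inr (Or.inr ⟨ho, fun v' hE => ih (hv v' hE)⟩)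

theorem value_le_coe_iff {v : V} {n : ℕ} : G.value i v ≤ n ↔ v ∈ G.attr i n := by
  refine ⟨fun h => ?_, fun h => iInf₂_le n h⟩
  by_contra hn
  have : ((n + 1 : ℕ) : ℕ∞) ≤ G.value i v := by
    refine le_iInf₂ fun k hk => ?_
    have : n < k := by
      by_contra! hkn
      exact hn (G.attr_mono i hkn hk)
    exact_mod_cast this
  have : n + 1 ≤ n := by exact_mod_cast this.trans h
  omega

theorem value_eq_zero {v : V} (h : v ∈ G.target i) : G.value i v = 0 := by
  have := (G.value_le_coe_iff i (n := 0)).2 h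
  simpa using this

theorem value_le_of_owner {v v' : V} (ho : G.arena.owner v = i) (hE : G.arena.E v v') :
    G.value i v ≤ G.value i v' + 1 := by
  cases h : G.value i v' with
  | top => simp
  | coe n =>
    have := (G.value_le_coe_iff i).1 h.le
    exact (G.value_le_coe_iff i (n := n + 1)).2 (Or.inr (Or.inl ⟨ho, v', hE, this⟩))

/-- Take a successor of largest value. If this is `n`, all successors lie in `attr n`, hence `v` in
`attr (n + 1)`. The coalition punishes `i` with these moves. -/
theorem exists_value_le [Finite V] {v : V} (ho : G.arena.owner v ≠ i) :
    ∃ v', G.arena.E v v' ∧ G.value i v ≤ G.value i v' + 1 := by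
  have : Nonempty {v' // G.arena.E v v'} := (G.arena.exists_succ v).elim fun v' h => ⟨⟨v', h⟩⟩
  obtain ⟨⟨v', hE⟩, hmax⟩ :=
    Finite.exists_max fun v' : {v' // G.arena.E v v'} => G.value i v'
  refine ⟨v', hE, ?_⟩
  cases h : G.value i v' with
  | top => simp
  | coe n =>
    refine (G.value_le_coe_iff i (n := n + 1)).2 (Or.inr (Or.inr ⟨ho, fun u hu => ?_⟩))
    rw [← G.value_le_coe_iff, ← h]
    exact hmax ⟨u, hu⟩

theorem value_le_of_owner_ne {v v' : V} {n : ℕ} (ht : v ∉ G.target i)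
    (ho : G.arena.owner v ≠ i) (h : G.value i v ≤ (n + 1 : ℕ)) (hE : G.arena.E v v') :
    G.value i v' ≤ n := by
  rcases (G.value_le_coe_iff i).1 h with h | h | h
  · exact absurd h ht
  · exact absurd h.1 ho
  · exact (G.value_le_coe_iff i).2 (h.2 v' hE)

/-- A successor that attains the exact value of `v` minus one serves all `n` simultaneously. Where
nothing is to be gained any edge is allowed, so that the move is defined everywhere. -/
theorem exists_attractor_move (v : V) : ∃ v', G.arena.E v v' ∧
    ∀ n : ℕ, v ∉ G.target i → G.arena.owner v = i → G.value i v ≤ (n + 1 : ℕ) →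
      G.value i v' ≤ n := by
  by_cases hv : v ∉ G.target i ∧ G.arena.owner v = i ∧ G.value i v ≠ ⊤
  · obtain ⟨ht, ho, hv⟩ := hv
    obtain ⟨k, hk⟩ := ENat.ne_top_iff_exists.1 hv
    have hmem := (G.value_le_coe_iff i).1 hk.ge
    cases k with
    | zero => exact absurd hmem ht
    | succ k =>
      rcases hmem with h | ⟨-, v', hE, h⟩ | h
      · exact absurd h ht
      · refine ⟨v', hE, fun n _ _ hn => ?_⟩
        rw [← hk] at hn
        have hkn : k + 1 ≤ n + 1 := by exact_mod_cast hn
        exact ((G.value_le_coe_iff i).2 h).trans (by exact_mod_cast (by omega : k ≤ n))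
      · exact absurd ho h.1
  · obtain ⟨v', hE⟩ := G.arena.exists_succ v
    refine ⟨v', hE, fun n ht ho hn => absurd ⟨ht, ho, fun h => ?_⟩ hv⟩
    rw [h] at hn
    exact absurd hn (by simp)

/-- A move towards the target set of player `i`. -/
noncomputable def attractorMove (v : V) : V := (G.exists_attractor_move i v).choose

theorem edge_attractorMove (v : V) : G.arena.E v (G.attractorMove i v) :=
  (G.exists_attractor_move i v).choose_spec.1

theorem value_attractorMove {v : V} {n : ℕ} (ht : v ∉ G.target i) (ho : G.arena.owner v = i)
    (h : G.value i v ≤ (n + 1 : ℕ)) : G.value i (G.attractorMove i v) ≤ n :=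
  (G.exists_attractor_move i v).choose_spec.2 n ht ho h

theorem reachCost_le_value {ρ : ℕ → V} (hρ : G.arena.IsPlay ρ)
    (hm : ∀ k, G.arena.owner (ρ k) = i → ρ (k + 1) = G.attractorMove i (ρ k)) :
    G.reachCost i ρ ≤ G.value i (ρ 0) := by
  cases h : G.value i (ρ 0) with
  | top => exact le_top
  | coe n =>
    replace h := h.le
    induction n generalizing ρ with
    | zero => exact G.reachCost_le i ((G.value_le_coe_iff i).1 h)
    | succ n ih =>
      by_cases ht : ρ 0 ∈ G.target i
      · exact (G.reachCost_le i ht).trans (by simp)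
      · have h1 : G.value i (shift 1 ρ 0) ≤ n := by
          by_cases ho : G.arena.owner (ρ 0) = i
          · rw [shift_apply, zero_add, ← zero_add 1, hm 0 ho]
            exact G.value_attractorMove i ht ho h
          · exact G.value_le_of_owner_ne i ht ho h (hρ 0)
        have := ih (hρ.shift 1) (fun k hk => hm (k + 1) hk) h1
        refine (G.reachCost_le_shift i 1 ρ).trans ((add_le_add_left this _).trans ?_)
        norm_cast

/-- Along the outcome of a Nash equilibrium, a player who has not yet visited his target set
pays at most what he could force after any deviation. -/
theorem reachCost_shift_le_value_of_isNE {v₀ : V} {σ : Profile P V}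
    (hσ : G.toGame.IsNE v₀ σ) {j : ℕ} {u : V}
    (hj : ∀ k ≤ j, G.arena.outcome σ v₀ k ∉ G.target (G.arena.owner (G.arena.outcome σ v₀ j)))
    (hu : G.arena.E (G.arena.outcome σ v₀ j) u) :
    G.reachCost (G.arena.owner (G.arena.outcome σ v₀ j)) (shift j (G.arena.outcome σ v₀)) ≤
      G.value (G.arena.owner (G.arena.outcome σ v₀ j)) u + 1 := by
  classical
  set ρ := G.arena.outcome σ v₀ with hdef
  set i := G.arena.owner (ρ j) with hi
  have hρ : G.arena.IsPlay ρ := hσ.1.isPlay_outcome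
  -- The deviation follows `σ` for `j` steps, moves to `u`, and then heads for the target set of `i`
  -- by attractor moves.
  let s : Strategy V := fun h v =>
    if h.length < j then σ i h v else if h = pref ρ j ∧ v = ρ j then u else G.attractorMove i v
  have hs : G.arena.IsStrategy v₀ i s := by
    intro h v hh hv
    simp only [s]
    split_ifs with h1 h2
    · exact hσ.1 i h v hh hv
    · rw [h2.2]; exact hu
    · exact G.edge_attractorMove i v
  have hne := hσ.2 i s hs
  change G.reachCost i ρ ≤ G.reachCost i (G.arena.outcome (Function.update σ i s) v₀) at hne
  have hπ : G.arena.IsPlay (G.arena.outcome (Function.update σ i s) v₀) :=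
    (hσ.1.update hs).isPlay_outcome
  set π := G.arena.outcome (Function.update σ i s) v₀ with hπdef
  have hagree : ∀ k ≤ j, π k = ρ k := by
    intro k
    induction k using Nat.strong_induction_on with
    | _ k ih =>
      intro hk
      cases k with
      | zero => rfl
      | succ k =>
        have hp : pref π k = pref ρ k := pref_congr fun l hl => ih l (by omega) (by omega)
        rw [hπdef, hdef, Arena.outcome_succ, Arena.outcome_succ, ← hπdef, ← hdef,
          ih k (by omega) (by omega), hp]
        by_cases ho : G.arena.owner (ρ k) = i
        · rw [ho, Function.update_self]
          simp only [s, length_pref]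
          rw [if_pos (by omega)]
        · rw [Function.update_of_ne ho]
  have hnext : π (j + 1) = u := by
    have hp : pref π j = pref ρ j := pref_congr fun l hl => hagree l hl.le
    rw [hπdef, Arena.outcome_succ, ← hπdef, hagree j le_rfl, ← hi, Function.update_self, hp]
    simp [s]
  have hafter : G.reachCost i (shift (j + 1) π) ≤ G.value i u := by
    have := G.reachCost_le_value i (hπ.shift (j + 1)) fun k hk => by
      simp only [shift_apply] at hk ⊢
      rw [add_right_comm, hπdef, Arena.outcome_succ, ← hπdef, hk, Function.update_self]
      simp only [s, length_pref]
      rw [if_neg (by omega), if_neg]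
      rintro ⟨h, -⟩
      have := congrArg List.length h
      simp only [length_pref] at this
      omega
    rwa [shift_apply, zero_add, hnext] at this
  have h1 : G.reachCost i ρ = G.reachCost i (shift j ρ) + j :=
    G.reachCost_eq_shift i fun k hk => hj k hk.le
  have h2 := G.reachCost_le_shift i (j + 1) π
  rw [h1] at hne
  have h3 : G.reachCost i (shift j ρ) + j ≤ G.value i u + 1 + j := by
    refine hne.trans (h2.trans ((add_le_add_left hafter _).trans (le_of_eq ?_)))
    push_cast
    ring
  exact (ENat.add_le_add_iff_right (ENat.natCast_ne_top j)).1 h3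

/-! ### Nash equilibria with small memory -/

/-- The play of the extended game that a sequence of vertices defines. -/
def lift (ρ : ℕ → V) : ℕ → V × Set P := fun k => (ρ k, {i | ∃ j ≤ k, ρ j ∈ G.target i})

variable {G i}

theorem isPlay_lift {ρ : ℕ → V} (hρ : G.arena.IsPlay ρ) :
    G.extended.arena.IsPlay (G.lift ρ) := by
  refine fun k => ⟨hρ k, ?_⟩
  ext i
  simp only [lift, visitAt, Set.mem_ofPred_eq, Set.mem_union]
  constructor
  · rintro ⟨j, hj, h⟩
    rcases Nat.le_succ_iff.1 hj with hj | rfl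
    · exact Or.inl ⟨j, hj, h⟩
    · exact Or.inr h
  · rintro (⟨j, hj, h⟩ | h)
    · exact ⟨j, by omega, h⟩
    · exact ⟨k + 1, le_rfl, h⟩

theorem lift_zero (ρ : ℕ → V) : G.lift ρ 0 = G.extendedInit (ρ 0) := by
  simp [lift, extendedInit, visitAt]

theorem eq_lift {v₀ : V} {ρ : ℕ → V × Set P} (hρ : G.extended.arena.IsPlay ρ)
    (h0 : ρ 0 = G.extendedInit v₀) : ρ = G.lift (Prod.fst ∘ ρ) := by
  funext k
  induction k with
  | zero => rw [lift_zero, Function.comp, h0]; rfl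
  | succ k ih =>
    refine Prod.ext rfl ?_
    have h1 : (ρ (k + 1)).2 = _ := (hρ k).2
    have h2 : (G.lift (Prod.fst ∘ ρ) (k + 1)).2 = _ :=
      (isPlay_lift (G := G) (ρ := Prod.fst ∘ ρ) (fun k => (hρ k).1) k).2
    rw [h1, h2, ih]
    rfl

theorem reachCost_lift (ρ : ℕ → V) : G.extended.reachCost i (G.lift ρ) = G.reachCost i ρ := by
  refine le_antisymm ?_ ?_
  · rw [le_reachCost_iff]
    exact fun k hk => G.extended.reachCost_le i ⟨k, le_rfl, hk⟩
  · rw [le_reachCost_iff]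
    rintro k ⟨j, hj, h⟩
    exact (G.reachCost_le i h).trans (by exact_mod_cast hj)

theorem isPlay_fst {ρ : ℕ → V × Set P} (hρ : G.extended.arena.IsPlay ρ) :
    G.arena.IsPlay (Prod.fst ∘ ρ) := fun k => (hρ k).1

theorem reachCost_ne_top_of_mem_visit {ρ : ℕ → V} (h : i ∈ G.visit ρ) :
    G.reachCost i ρ ≠ ⊤ := by
  obtain ⟨n, hn⟩ := h
  exact ((G.reachCost_le i hn).trans_lt (ENat.natCast_lt_top n)).ne

end ReachGame

open ReachGame in
/-- The first claim: Nash equilibria with small memory and short outcome. -/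
theorem exists_simple_nashEquilibrium [Fintype P] [Fintype V] (G : ReachGame P V) (v₀ : V)
    (σ : Profile P V) (y : P → ℕ∞) (hσ : G.toGame.IsNE v₀ σ)
    (hy : G.toGame.costProfile v₀ σ ≤ y) :
    ∃ τ : Profile P V,
      G.toGame.IsNE v₀ τ ∧
      G.toGame.costProfile v₀ τ ≤ y ∧
      G.arena.IsLassoOfLengthLE (G.arena.outcome τ v₀)
        ((Fintype.card P + 1) * Fintype.card V) ∧
      (∀ i ∈ G.visit (G.arena.outcome τ v₀),
        G.toGame.costProfile v₀ τ i ≤ ((Fintype.card P * Fintype.card V : ℕ) : ℕ∞)) ∧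
      G.arena.HasMemoryLE v₀ τ (3 * ((Fintype.card P + 1) * Fintype.card V)) := by
  classical
  set ρ := G.arena.outcome σ v₀ with hρdef
  have hρ : G.arena.IsPlay ρ := hσ.1.isPlay_outcome
  obtain ⟨π, hπ, hπ0, hπcost, hπtail, hπfin, hπcard, hπbound⟩ :=
    G.exists_short_lasso (isPlay_lift hρ)
  rw [lift_zero] at hπ0
  have hπlift := eq_lift hπ hπ0
  have hcost : ∀ i, G.reachCost i (Prod.fst ∘ π) = G.extended.reachCost i π := fun i => by
    conv_rhs => rw [hπlift, reachCost_lift]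
  -- A player who has already visited pays `0` in the extended game. For any other, the suffix of
  -- `π` costs no more than one of `ρ` at the same vertex, to which the equilibrium inequality
  -- applies.
  have hcons : ∀ k u, G.arena.E (π k).1 u →
      G.extended.reachCost (G.arena.owner (π k).1) (shift k π) ≤
        G.value (G.arena.owner (π k).1) u + 1 := by
    intro k u hu
    by_cases hi : G.arena.owner (π k).1 ∈ (π k).2
    · rw [(G.extended.reachCost_eq_zero_iff _).2 (by
        rw [shift_apply, zero_add]; exact hi)]
      exact zero_le
    · obtain ⟨j, hj, hle⟩ := hπtail k
      refine (hle _).trans ?_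
      rw [hj] at hu hi ⊢
      have h1 : ∀ k ≤ j, ρ k ∉ G.target (G.arena.owner (ρ j)) := fun k hk h => hi ⟨k, hk, h⟩
      have h2 := G.reachCost_shift_le_value_of_isNE hσ h1 hu
      have h3 := G.reachCost_eq_shift _ fun k hk => h1 k (le_of_lt hk)
      have h4 := G.extended.reachCost_eq_shift (G.arena.owner (ρ j)) (ρ := G.lift ρ) (k := j)
        fun k hk ⟨l, hl, h⟩ => h1 l (by omega) h
      rw [reachCost_lift, h3] at h4
      have h5 := ENat.add_left_injective_of_ne_top (ENat.natCast_ne_top j) h4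
      exact h5.symm.le.trans h2
  have hmove : ∀ (i : P) (v : V), ∃ v', G.arena.E v v' ∧ G.value i v ≤ G.value i v' + 1 := by
    intro i v
    by_cases ho : G.arena.owner v = i
    · obtain ⟨v', hE⟩ := G.arena.exists_succ v
      exact ⟨v', hE, G.value_le_of_owner i ho hE⟩
    · exact G.exists_value_le i ho
  choose pun hpunE hpun using hmove
  have : Fintype (tails π) := hπfin.fintype
  -- The states are the suffixes of the lasso, and pairs `(i, v)` where `v` is the current vertex
  -- while `i` is being punished.
  let M : Automaton G.arena (tails π ⊕ (P × V)) :=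
    { vert := Sum.elim (fun q => (q.1 0).1) Prod.snd
      step := Sum.map (fun q => ⟨shift 1 q.1, shift_one_mem_tails q.2⟩)
        fun q => (q.1, pun q.1 q.2)
      dev := fun v i => Sum.inr (i, v)
      edge := by
        rintro (⟨_, k, rfl⟩ | ⟨i, v⟩)
        · exact ((hπ.shift k) 0).1
        · exact hpunE i v
      vert_dev := fun q v _ => rfl }
  let q₀ : tails π ⊕ (P × V) := Sum.inl ⟨π, self_mem_tails π⟩
  have hq₀ : M.vert q₀ = v₀ := by
    change (π 0).1 = v₀
    rw [hπ0]; rfl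
  have hplay : M.play q₀ = Prod.fst ∘ π := by
    have : ∀ k, M.step^[k] q₀ = Sum.inl ⟨shift k π, k, rfl⟩ := by
      intro k
      induction k with
      | zero => rfl
      | succ k ih =>
        rw [Function.iterate_succ_apply', ih]
        simp [M, shift_shift, add_comm]
    funext k
    rw [Automaton.play, this]
    simp [M, shift]
  have hout : G.arena.outcome (M.profile q₀) v₀ = Prod.fst ∘ π := by
    rw [← hq₀, M.outcome_profile, hplay]
  have hprof : ∀ i, G.toGame.costProfile v₀ (M.profile q₀) i = G.extended.reachCost i π := by
    intro i
    rw [← hcost i, ← hout]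
    rfl
  refine ⟨M.profile q₀, ⟨?_, ?_⟩, ?_, ?_, ?_, ?_⟩
  · have := M.isProfile_profile q₀
    rwa [hq₀] at this
  · intro i s hs
    rw [hprof]
    let c : tails π ⊕ (P × V) → ℕ∞ :=
      Sum.elim (fun q => G.extended.reachCost i q.1) fun q => G.value q.1 q.2
    have := M.le_reachCost_deviation G rfl (q₀ := q₀) (h := []) (v := v₀)
      (by rw [hq₀]; exact G.arena.isHistoryFrom_singleton v₀) i
      -- In a state `(j, v)` with `j ≠ i` the potential would measure the value for the wrong
      -- player. Deviations of `i` never lead there.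
      (S := {q | ∀ j v, q = Sum.inr (j, v) → j = i}) (c := c) ?_ ?_ ?_ ?_ hs
    · exact this
    · intro j v h
      exact absurd h (by simp [Automaton.state_singleton, q₀])
    · rintro (⟨q, hq⟩ | ⟨j, v⟩) hS
      · refine ⟨by simp [M], ?_⟩
        exact G.extended.reachCost_le_shift i 1 q
      · refine ⟨?_, hpun j v⟩
        obtain rfl := hS j v rfl
        simp [M]
    · rintro (⟨_, k, rfl⟩ | ⟨j, v⟩) hS ho u hE
      · refine ⟨by simp [M], ?_⟩
        have ho' : G.arena.owner (π k).1 = i := by simpa [M, shift] using ho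
        have := hcons k u (by simpa [M, shift] using hE)
        rwa [ho'] at this
      · obtain rfl := hS j v rfl
        exact ⟨by simp [M], G.value_le_of_owner j ho hE⟩
    · rintro (⟨_, k, rfl⟩ | ⟨j, v⟩) hS ht
      · refine (G.extended.reachCost_eq_zero_iff i).2 ?_
        have ht' : (π k).1 ∈ G.target i := by simpa [M, shift] using ht
        change i ∈ (shift k π 0).2
        rw [shift_apply, zero_add, hπlift]
        exact ⟨k, le_rfl, ht'⟩
      · obtain rfl := hS j v rfl
        exact G.value_eq_zero j ht
  · intro i
    rw [hprof]
    refine (hπcost i).trans ?_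
    rw [reachCost_lift]
    exact hy i
  · rw [hout]
    refine G.arena.isLassoOfLengthLE_of_tails (isPlay_fst hπ) ?_ ?_
    · rw [tails_comp]; exact hπfin.image _
    · rw [tails_comp]; exact (Set.ncard_image_le hπfin).trans hπcard
  · intro i hi
    rw [hprof]
    refine hπbound i ?_
    rw [hout] at hi
    rw [← hcost]
    exact reachCost_ne_top_of_mem_visit hi
  · refine M.hasMemoryLE_profile v₀ q₀ ?_
    have hV : 0 < Fintype.card V := Fintype.card_pos_iff.2 ⟨v₀⟩
    have h1 : Fintype.card (tails π) = (tails π).ncard := by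
      rw [← Nat.card_eq_fintype_card]; rfl
    rw [Fintype.card_sum, Fintype.card_prod, h1]
    nlinarith

theorem pref_succ_eq_cons (ρ : ℕ → V) (n : ℕ) : pref ρ (n + 1) = ρ 0 :: pref (shift 1 ρ) n := by
  simp [pref, List.range_succ_eq_map, Function.comp_def, shift]

/-! ### Enforceable bounds, pumping and truncation of plays -/

namespace ReachGame

variable (G : ReachGame P V)

/-- Along `ρ`, at each vertex `x` its owner pays at most `L x` from there on. -/
def Consistent (L : V × Set P → ℕ∞) (ρ : ℕ → V × Set P) : Prop :=
  ∀ k, G.extended.reachCost (G.arena.owner (ρ k).1) (shift k ρ) ≤ L (ρ k)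

/-- On the set `R`, the bounds `L` can be enforced: whenever the owner of `x` moves from `x` to
`x'`, he can be made to pay `L x`, or arbitrarily much if `L x` is infinite, by a play that
respects the bounds. -/
structure IsValid (R : Set (V × Set P)) (L : V × Set P → ℕ∞) : Prop where
  zero : ∀ x ∈ R, G.arena.owner x.1 ∈ x.2 → L x = 0
  deter : ∀ x ∈ R, ∀ x', G.extended.arena.E x x' → ∀ N : ℕ, N ≤ L x →
    ∃ ρ, G.extended.arena.IsPlay ρ ∧ ρ 0 = x' ∧ G.Consistent L ρ ∧
      N ≤ G.extended.reachCost (G.arena.owner x.1) ρ + 1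

variable {G} {L L' : V × Set P → ℕ∞} {ρ π : ℕ → V × Set P} {R : Set (V × Set P)}

theorem Consistent.mono (h : G.Consistent L ρ) (hL : L ≤ L') : G.Consistent L' ρ :=
  fun k => (h k).trans (hL _)

theorem Consistent.shift (h : G.Consistent L ρ) (k : ℕ) : G.Consistent L (shift k ρ) := by
  intro l
  rw [shift_shift, shift_apply]
  exact h (l + k)

theorem Consistent.of_tail (h : G.Consistent L ρ) (hπ : ∀ k, ∃ j, π k = ρ j ∧
    ∀ i, G.extended.reachCost i (ReachabilityGames.shift k π) ≤
      G.extended.reachCost i (ReachabilityGames.shift j ρ)) : G.Consistent L π := by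
  intro k
  obtain ⟨j, hj, hle⟩ := hπ k
  rw [hj]
  exact (hle _).trans (h j)

theorem mem_of_isPlay (hR : ∀ x ∈ R, ∀ x', G.extended.arena.E x x' → x' ∈ R)
    (hρ : G.extended.arena.IsPlay ρ) (h0 : ρ 0 ∈ R) (k : ℕ) : ρ k ∈ R := by
  induction k with
  | zero => exact h0
  | succ k ih => exact hR _ ih _ (hρ k)

/-- If the finite bounds along a play are at most `a` and a player pays much, then a cycle of the
play can be repeated forever. -/
theorem exists_pumped_play [Fintype P] [Fintype V] (hρ : G.extended.arena.IsPlay ρ)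
    (hL : G.Consistent L ρ) {a : ℕ} (ha : ∀ k, L (ρ k) = ⊤ ∨ L (ρ k) ≤ a) {i : P}
    (hi : ((Fintype.card P * (a + Fintype.card V) : ℕ) : ℕ∞) < G.extended.reachCost i ρ) :
    ∃ π, G.extended.arena.IsPlay π ∧ π 0 = ρ 0 ∧ G.Consistent L π ∧
      G.extended.reachCost i π = ⊤ ∧ (tails π).Finite ∧
      (tails π).ncard ≤ Fintype.card P * (a + Fintype.card V) := by
  classical
  set n := Fintype.card P with hn
  set m := Fintype.card V with hm
  have hmono := snd_mono_of_isPlay hρ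
  have hnot : ∀ k ≤ n * (a + m), i ∉ (ρ k).2 := fun k hk =>
    notMem_of_lt_reachCost (lt_of_le_of_lt (by exact_mod_cast hk) hi)
  -- Cut the first `n * (a + m)` steps into `n` blocks. Since `i` is never visited there, the
  -- visited set cannot grow in every block.
  obtain ⟨j, hjn, hj⟩ : ∃ j < n, (ρ ((j + 1) * (a + m))).2 ⊆ (ρ (j * (a + m))).2 := by
    by_contra! hc
    have : ∀ j ≤ n, j ≤ (ρ (j * (a + m))).2.ncard := by
      intro j hj
      induction j with
      | zero => exact Nat.zero_le _
      | succ j ih =>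
        refine Nat.succ_le_of_lt (lt_of_le_of_lt (ih (by omega)) ?_)
        exact Set.ncard_lt_ncard ⟨hmono (Nat.mul_le_mul_right _ (Nat.le_succ j)), hc j (by omega)⟩
          (Set.toFinite _)
    have h1 := this n le_rfl
    have h2 := ncard_lt_card_of_notMem (hnot _ le_rfl)
    omega
  set s := j * (a + m) with hs
  have hsn : s + (a + m) ≤ n * (a + m) := by
    rw [hs, ← Nat.succ_mul]
    exact Nat.mul_le_mul_right _ hjn
  rw [Nat.succ_mul, ← hs] at hj
  have hconst : ∀ k, s ≤ k → k ≤ s + (a + m) → (ρ k).2 = (ρ s).2 := fun k h1 h2 =>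
    ((hmono h2).trans hj).antisymm (hmono h1)
  -- A vertex repeats within the first `m` steps of the block. The other `a` steps leave room for
  -- the finite bounds to fall due inside the block.
  obtain ⟨p, q, hsp, hpq, hqs, heq⟩ : ∃ p q, s ≤ p ∧ p < q ∧ q ≤ s + m ∧ ρ p = ρ q := by
    obtain ⟨b, hb, c, hc, hbc, h⟩ := Finset.exists_ne_map_eq_of_card_lt_of_maps_to
      (s := Finset.range (m + 1)) (t := (Finset.univ : Finset V)) (f := fun k => (ρ (s + k)).1)
      (by rw [Finset.card_range, Finset.card_univ]; omega) (fun _ _ => Finset.mem_univ _)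
    rw [Finset.mem_range] at hb hc
    have hval : ρ (s + b) = ρ (s + c) := Prod.ext h
      ((hconst _ (by omega) (by omega)).trans (hconst _ (by omega) (by omega)).symm)
    rcases lt_or_gt_of_ne hbc with h' | h'
    · exact ⟨s + b, s + c, by omega, by omega, by omega, hval⟩
    · exact ⟨s + c, s + b, by omega, by omega, by omega, hval.symm⟩
  let step : ℕ → ℕ := fun t => if t + 1 < q then t + 1 else p
  have hstep_lt : ∀ t, step t < q := by
    intro t
    simp only [step]
    split_ifs <;> omega
  have hlt : ∀ k, step^[k] 0 < q := by
    intro k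
    cases k with
    | zero => simp only [Function.iterate_zero, id_eq]; omega
    | succ k => rw [Function.iterate_succ_apply']; exact hstep_lt _
  have hstep : ∀ t < q, ρ (step t) = ρ (t + 1) := by
    intro t ht
    simp only [step]
    split_ifs with h
    · rfl
    · rw [heq]
      congr 1
      omega
  have hfwd : ∀ d t, t + d < q → step^[d] t = t + d := by
    intro d
    induction d with
    | zero => intro t _; rfl
    | succ d ih =>
      intro t ht
      rw [Function.iterate_succ_apply', ih t (by omega)]
      simp only [step]
      rw [if_pos (by omega)]
      omega
  let π : ℕ → V × Set P := fun k => ρ (step^[k] 0)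
  have hshift : ∀ k, shift k π = fun d => ρ (step^[d] (step^[k] 0)) := by
    intro k
    funext d
    simp only [shift_apply, π, Function.iterate_add_apply]
  refine ⟨π, fun k => ?_, rfl, fun k => ?_, ?_, ?_⟩
  · simp only [π]
    rw [Function.iterate_succ_apply', hstep _ (hlt k)]
    exact hρ _
  · have htq := hlt k
    rw [hshift]
    simp only [π]
    set t := step^[k] 0
    set i₀ := G.arena.owner (ρ t).1
    rcases ha t with h | h
    · rw [h]; exact le_top
    · have hc := (hL t).trans h
      obtain ⟨d, hd⟩ := ENat.ne_top_iff_exists.1 (hc.trans_lt (ENat.natCast_lt_top a)).ne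
      have hda : d ≤ a := by rw [← hd] at hc; exact_mod_cast hc
      refine le_trans ?_ (hL t)
      rw [← hd]
      obtain ⟨d', hd', hmem⟩ := (G.extended.reachCost_le_coe_iff i₀).1 hd.ge
      have hle : ∀ l, i₀ ∈ (ρ (l + t)).2 → d ≤ l := fun l hl => by
        have := G.extended.reachCost_le i₀ (ρ := shift t ρ) (k := l) hl
        rw [← hd] at this
        exact_mod_cast this
      obtain rfl : d = d' := le_antisymm (hle d' hmem) hd'
      -- A visit due at `q` or later would still fall in the block, where the visited set is
      -- constant. The target set would then have been visited by time `s`, so the visit would be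
      -- due before `q`.
      have hdq : t + d < q := by
        by_contra! hqd
        have h1 : i₀ ∈ (ρ s).2 := hj (hmono (by omega : d + t ≤ s + (a + m)) hmem)
        have h2 := hle (s - t) (hmono (by omega : s ≤ s - t + t) h1)
        omega
      refine G.extended.reachCost_le i₀ (k := d) ?_
      rw [hfwd d t hdq, add_comm]
      exact hmem
  · refine (G.extended.reachCost_eq_top_iff i).2 fun k => hnot _ ?_
    have := hlt k
    omega
  · have hsub : tails π ⊆ (fun t d => ρ (step^[d] t)) '' (Finset.range q : Set ℕ) := by
      rintro _ ⟨k, rfl⟩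
      exact ⟨step^[k] 0, by simpa using hlt k, (hshift k).symm⟩
    have hfin : ((fun t d => ρ (step^[d] t)) '' (Finset.range q : Set ℕ)).Finite :=
      (Finset.finite_toSet _).image _
    refine ⟨hfin.subset hsub, (Set.ncard_le_ncard hsub hfin).trans ?_⟩
    refine (Set.ncard_image_le (Finset.finite_toSet _)).trans ?_
    rw [Set.ncard_coe_finset, Finset.card_range]
    omega

/-- A play can be shortened after its first `N` steps. -/
theorem exists_truncated_play [Fintype P] [Fintype V] (hρ : G.extended.arena.IsPlay ρ)
    (hL : G.Consistent L ρ) {N : ℕ} {i : P} (hi : N ≤ G.extended.reachCost i ρ + 1) :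
    ∃ π, G.extended.arena.IsPlay π ∧ π 0 = ρ 0 ∧ G.Consistent L π ∧
      N ≤ G.extended.reachCost i π + 1 ∧ (tails π).Finite ∧
      (tails π).ncard ≤ N + (Fintype.card P + 1) * Fintype.card V := by
  classical
  obtain ⟨π', hπ', h0, hcost, htail, hfin, hcard, -⟩ := G.exists_short_lasso (hρ.shift N)
  -- Keeping the positions up to `N` secures the cost `N - 1` for `i`. The bounds on the kept part
  -- survive because the new tail costs nobody more.
  let π : ℕ → V × Set P := fun t => if t < N then ρ t else π' (t - N)
  have hlt : ∀ t ≤ N, π t = ρ t := by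
    intro t ht
    simp only [π]
    split_ifs with h
    · rfl
    · obtain rfl : t = N := by omega
      rw [Nat.sub_self, h0, shift_apply, zero_add]
  have hshift : shift N π = π' := by
    funext t
    simp [shift, π]
  refine ⟨π, fun k => ?_, hlt 0 (Nat.zero_le N), fun k => ?_, ?_, ?_⟩
  · by_cases hk : k < N
    · rw [hlt k hk.le, hlt (k + 1) hk]
      exact hρ k
    · obtain ⟨l, rfl⟩ := Nat.exists_eq_add_of_le (not_lt.1 hk)
      have := hπ' l
      rw [← hshift] at this
      rwa [shift_apply, shift_apply, add_comm l N, add_right_comm, add_comm l N] at this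
  · by_cases hk : k < N
    · rw [hlt k hk.le]
      refine le_trans ?_ (hL k)
      refine G.extended.reachCost_mono_of_agree _ (k := N - k) (fun l hl => hlt _ (by omega)) ?_
      rw [shift_shift, shift_shift, Nat.sub_add_cancel hk.le, hshift]
      exact hcost _
    · obtain ⟨l, rfl⟩ := Nat.exists_eq_add_of_le (not_lt.1 hk)
      have := ((hL.shift N).of_tail htail) l
      rw [← hshift, shift_shift, shift_apply, add_comm l N] at this
      exact this
  · cases N with
    | zero => simp
    | succ N =>
      have hN : (N : ℕ∞) ≤ G.extended.reachCost i π := by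
        rw [le_reachCost_iff]
        intro k hk
        by_cases hkN : k ≤ N
        · rw [hlt k (by omega)] at hk
          have := hi.trans (add_le_add_left (G.extended.reachCost_le i hk) 1)
          have : N + 1 ≤ k + 1 := by exact_mod_cast this
          exact_mod_cast (by omega : N ≤ k)
        · exact_mod_cast (by omega : N ≤ k)
      rw [Nat.cast_succ]
      gcongr
  · have hsub : tails π ⊆ (fun k => shift k π) '' (Finset.range N : Set ℕ) ∪ tails π' := by
      rintro _ ⟨k, rfl⟩
      by_cases hk : k < N
      · exact Or.inl ⟨k, by simpa using hk, rfl⟩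
      · refine Or.inr ⟨k - N, ?_⟩
        simp only
        rw [← hshift, shift_shift, Nat.sub_add_cancel (not_lt.1 hk)]
    have hfin' := ((Finset.finite_toSet (Finset.range N)).image fun k => shift k π).union hfin
    refine ⟨hfin'.subset hsub, (Set.ncard_le_ncard hsub hfin').trans ?_⟩
    refine (Set.ncard_union_le _ _).trans (add_le_add ?_ hcard)
    refine (Set.ncard_image_le (Finset.finite_toSet _)).trans ?_
    rw [Set.ncard_coe_finset, Finset.card_range]

end ReachGame

/-! ### Bounding the finite values of minimal valid bounds -/

/-- If no finite bound of a region lies between `a` and `gapBound n m a`, then none is larger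
than `a`. -/
def gapBound (n m a : ℕ) : ℕ := n * (a + m) + 1

theorem le_gapBound {n : ℕ} (hn : 0 < n) (m a : ℕ) : a ≤ gapBound n m a := by
  unfold gapBound
  nlinarith

theorem le_iterate_gapBound {n : ℕ} (hn : 0 < n) (m k a : ℕ) : a ≤ (gapBound n m)^[k] a :=
  Function.id_le_iterate_of_id_le (le_gapBound hn m) k a

namespace ReachGame

variable {G : ReachGame P V} {L : V × Set P → ℕ∞} {R : Set (V × Set P)}

/-- The bounds `L` are valid, and no larger valid bounds have fewer finite values. -/
structure IsMinimalValid (G : ReachGame P V) (R : Set (V × Set P)) (L : V × Set P → ℕ∞) :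
    Prop where
  closed : ∀ x ∈ R, ∀ x', G.extended.arena.E x x' → x' ∈ R
  valid : G.IsValid R L
  minimal : ∀ L', G.IsValid R L' → L ≤ L' →
    {x | x ∈ R ∧ L x ≠ ⊤}.ncard ≤ {x | x ∈ R ∧ L' x ≠ ⊤}.ncard

theorem IsValid.exists_isMinimalValid
    (hR : ∀ x ∈ R, ∀ x', G.extended.arena.E x x' → x' ∈ R) (hL : G.IsValid R L) :
    ∃ L', L ≤ L' ∧ G.IsMinimalValid R L' := by
  obtain ⟨L', ⟨hle, hL'⟩, hmin⟩ :=
    (InvImage.wf (fun L' : V × Set P → ℕ∞ => {x | x ∈ R ∧ L' x ≠ ⊤}.ncard)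
      (wellFounded_lt (α := ℕ))).has_min {L' | L ≤ L' ∧ G.IsValid R L'} ⟨L, le_rfl, hL⟩
  exact ⟨L', hle, hR, hL', fun L'' h1 h2 => not_lt.1 (hmin L'' ⟨hle.trans h2, h1⟩)⟩

variable [Fintype P] [Fintype V]

/-- Otherwise raise all bounds above the gap to `⊤`. From there on only bounds that are infinite or
at most `a` occur, and a punishment of cost at least `n * (a + m) + 1` can be pumped into one of
infinite cost. The new bounds are thus valid with fewer finite values. -/
theorem IsMinimalValid.no_gap (hL : G.IsMinimalValid R L) {I : Set P} {a : ℕ}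
    (hup : ∀ x ∈ R, I ⊂ x.2 → L x = ⊤ ∨ L x ≤ a)
    (hgap : ∀ x ∈ R, x.2 = I → L x = ⊤ ∨ L x ≤ a ∨
      (gapBound (Fintype.card P) (Fintype.card V) a : ℕ) < L x) :
    ∀ x ∈ R, x.2 = I → L x = ⊤ ∨ L x ≤ a := by
  classical
  by_contra! hc
  obtain ⟨x₁, hx₁, hI₁, htop₁, ha₁⟩ := hc
  set b := gapBound (Fintype.card P) (Fintype.card V) a with hb
  have hgap₁ : (b : ℕ∞) < L x₁ := by
    rcases hgap x₁ hx₁ hI₁ with h | h | h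
    · exact absurd h htop₁
    · exact absurd h (not_le.2 ha₁)
    · exact h
  let L' : V × Set P → ℕ∞ := fun x => if x ∈ R ∧ x.2 = I ∧ (b : ℕ∞) < L x then ⊤ else L x
  have hle : L ≤ L' := by
    intro x
    simp only [L']
    split_ifs
    · exact le_top
    · exact le_rfl
  have hbound : ∀ x ∈ R, I ⊆ x.2 → L' x = ⊤ ∨ L' x ≤ a := by
    intro x hx hI
    simp only [L']
    split_ifs with h
    · exact Or.inl rfl
    · by_cases hxI : x.2 = I
      · rcases hgap x hx hxI with h' | h' | h'
        · exact Or.inl h'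
        · exact Or.inr h'
        · exact absurd ⟨hx, hxI, h'⟩ h
      · exact hup x hx (lt_of_le_of_ne hI (Ne.symm hxI))
  have hvalid : G.IsValid R L' := by
    refine ⟨fun x hx ho => ?_, fun x hx x' hE N hN => ?_⟩
    · have h0 := hL.valid.zero x hx ho
      simp only [L']
      rw [if_neg (fun h => by rw [h0] at h; exact absurd h.2.2 (by simp)), h0]
    · by_cases h : x ∈ R ∧ x.2 = I ∧ (b : ℕ∞) < L x
      · have hbL : ((b + 1 : ℕ) : ℕ∞) ≤ L x := by
          push_cast
          exact Order.add_one_le_of_lt h.2.2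
        obtain ⟨ρ, hρ, h0, hcons, hcost⟩ := hL.valid.deter x hx x' hE (b + 1) hbL
        have hmem := mem_of_isPlay hL.closed hρ (by rw [h0]; exact hL.closed x hx x' hE)
        have hI : ∀ k, I ⊆ (ρ k).2 := fun k => by
          rw [← h.2.1]
          refine (G.extended_edge_subset hE).trans ?_
          rw [← h0]
          exact snd_mono_of_isPlay hρ (Nat.zero_le k)
        have hcost' : (b : ℕ∞) ≤ G.extended.reachCost (G.arena.owner x.1) ρ := by
          push_cast at hcost
          exact (ENat.add_le_add_iff_right ENat.one_ne_top).1 hcost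
        obtain ⟨π, hπ, hπ0, hπL, hπtop, -⟩ := exists_pumped_play hρ (hcons.mono hle)
          (fun k => hbound _ (hmem k) (hI k))
          (lt_of_lt_of_le (by exact_mod_cast Nat.lt_succ_self _) hcost')
        exact ⟨π, hπ, hπ0.trans h0, hπL, by simp [hπtop]⟩
      · simp only [L', if_neg h] at hN
        obtain ⟨ρ, hρ, h0, hcons, hcost⟩ := hL.valid.deter x hx x' hE N hN
        exact ⟨ρ, hρ, h0, hcons.mono hle, hcost⟩
  refine absurd (hL.minimal L' hvalid hle) (not_le.2 ?_)
  refine Set.ncard_lt_ncard ⟨fun x hx => ⟨hx.1, fun h => hx.2 ?_⟩, fun h => ?_⟩ (Set.toFinite _)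
  · have := hle x
    rw [h] at this
    exact top_le_iff.1 this
  · refine (h (show x₁ ∈ {x | x ∈ R ∧ L x ≠ ⊤} from ⟨hx₁, htop₁⟩)).2 ?_
    simp only [L']
    rw [if_pos ⟨hx₁, hI₁, hgap₁⟩]

/-- The sets `D j` of vertices with a finite bound above the `j`-th iterate decrease. Two equal
consecutive nonempty ones would exhibit a gap, so they shrink strictly and are empty after `m`
steps. -/
theorem IsMinimalValid.region_bound (hL : G.IsMinimalValid R L) {I : Set P} {a : ℕ}
    (hP : 0 < Fintype.card P) (hup : ∀ x ∈ R, I ⊂ x.2 → L x = ⊤ ∨ L x ≤ a) :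
    ∀ x ∈ R, x.2 = I → L x = ⊤ ∨
      L x ≤ ((gapBound (Fintype.card P) (Fintype.card V))^[Fintype.card V] a : ℕ) := by
  classical
  set f := gapBound (Fintype.card P) (Fintype.card V) with hf
  let D : ℕ → Set V := fun j => {v | (v, I) ∈ R ∧ L (v, I) ≠ ⊤ ∧ ((f^[j] a : ℕ) : ℕ∞) < L (v, I)}
  have hsub : ∀ j, D (j + 1) ⊆ D j := by
    rintro j v ⟨h1, h2, h3⟩
    refine ⟨h1, h2, lt_of_le_of_lt ?_ h3⟩
    rw [Function.iterate_succ_apply']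
    exact_mod_cast le_gapBound hP _ _
  have hD : ∀ j, (D j).ncard ≤ Fintype.card V - j := by
    intro j
    induction j with
    | zero =>
      rw [Nat.sub_zero, ← Nat.card_eq_fintype_card, ← Set.ncard_univ]
      exact Set.ncard_le_ncard (Set.subset_univ _) (Set.toFinite _)
    | succ j ih =>
      rcases (D j).eq_empty_or_nonempty with he | ⟨v, hv⟩
      · have : D (j + 1) = ∅ := Set.subset_empty_iff.1 (he ▸ hsub j)
        rw [this, Set.ncard_empty]
        exact Nat.zero_le _
      · suffices (D (j + 1)).ncard < (D j).ncard by omega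
        refine Set.ncard_lt_ncard ⟨hsub j, fun hle => ?_⟩ (Set.toFinite _)
        have hgap := hL.no_gap (I := I) (a := f^[j] a)
          (fun x hx hI => (hup x hx hI).imp id fun h => h.trans
            (by exact_mod_cast le_iterate_gapBound hP _ j a))
          (fun x hx hI => by
            by_contra! hc
            obtain ⟨v', I'⟩ := x
            obtain rfl : I' = I := hI
            have h1 : v' ∈ D j := ⟨hx, hc.1, hc.2.1⟩
            have h2 := (hle h1).2.2
            rw [Function.iterate_succ_apply'] at h2
            exact absurd h2 (not_lt.2 hc.2.2))
          (v, I) hv.1 rfl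
        rcases hgap with h | h
        · exact hv.2.1 h
        · exact absurd hv.2.2 (not_lt.2 h)
  rintro ⟨v, I'⟩ hx hI
  obtain rfl : I' = I := hI
  by_contra! hc
  have hv : v ∈ D (Fintype.card V) := ⟨hx, hc.1, hc.2⟩
  have h0 := hD (Fintype.card V)
  rw [Nat.sub_self, Nat.le_zero, Set.ncard_eq_zero (Set.toFinite _)] at h0
  rw [h0] at hv
  exact hv

/-- Induction on the number of players still to visit. When there are none, the owner has visited
and the bound is `0`. -/
theorem IsMinimalValid.bound (hL : G.IsMinimalValid R L) (hP : 0 < Fintype.card P) :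
    ∀ x ∈ R, L x = ⊤ ∨ L x ≤ ((gapBound (Fintype.card P) (Fintype.card V))^[
      Fintype.card V * Fintype.card P] 0 : ℕ) := by
  have key : ∀ l, ∀ x ∈ R, Fintype.card P ≤ x.2.ncard + l → L x = ⊤ ∨
      L x ≤ ((gapBound (Fintype.card P) (Fintype.card V))^[Fintype.card V * l] 0 : ℕ) := by
    intro l
    induction l with
    | zero =>
      intro x hx hl
      right
      rw [hL.valid.zero x hx]
      · exact zero_le
      · by_contra hi
        have := ncard_lt_card_of_notMem hi
        omega
    | succ l ih =>
      intro x hx hl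
      have hiter : (gapBound (Fintype.card P) (Fintype.card V))^[Fintype.card V * (l + 1)] 0 =
          (gapBound (Fintype.card P) (Fintype.card V))^[Fintype.card V]
            ((gapBound (Fintype.card P) (Fintype.card V))^[Fintype.card V * l] 0) := by
        rw [← Function.iterate_add_apply, Nat.mul_succ, add_comm]
      rw [hiter]
      refine hL.region_bound (I := x.2) hP (fun x' hx' hI => ih x' hx' ?_) x hx rfl
      have := Set.ncard_lt_ncard hI (Set.toFinite _)
      omega
  exact fun x hx => key _ x hx (by omega)

/-- Deviations from vertices in `R` can be punished by lassos of bounded size. -/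
theorem IsMinimalValid.exists_punishment (hL : G.IsMinimalValid R L) {B : ℕ}
    (hB : ∀ x ∈ R, L x = ⊤ ∨ L x ≤ B) {x' : V × Set P} {i : P}
    (hx' : ∃ x ∈ R, G.extended.arena.E x x' ∧ G.arena.owner x.1 = i) :
    ∃ ρ, G.extended.arena.IsPlay ρ ∧ ρ 0 = x' ∧ G.Consistent L ρ ∧ (tails ρ).Finite ∧
      (tails ρ).ncard ≤ Fintype.card P * (B + Fintype.card V) + B +
        (Fintype.card P + 1) * Fintype.card V ∧
      ∀ x ∈ R, G.extended.arena.E x x' → G.arena.owner x.1 = i →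
        L x ≤ G.extended.reachCost i ρ + 1 := by
  classical
  -- Punishing for the predecessor with the largest bound suffices for all of them. Hence a
  -- punishment depends only on `x'` and `i`, which saves memory.
  obtain ⟨x, ⟨hx, hE, ho⟩, hmax⟩ := Set.exists_max_image
    {x | x ∈ R ∧ G.extended.arena.E x x' ∧ G.arena.owner x.1 = i} L (Set.toFinite _) hx'
  cases hc : L x with
  | top =>
    -- One extra unit pays for the move to `x'`, the other makes the cost exceed the pumping
    -- threshold strictly.
    obtain ⟨ρ, hρ, h0, hcons, hcost⟩ := hL.valid.deter x hx x' hE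
      (Fintype.card P * (B + Fintype.card V) + 1 + 1) (by rw [hc]; exact le_top)
    have hmem := mem_of_isPlay hL.closed hρ (by rw [h0]; exact hL.closed x hx x' hE)
    rw [Nat.cast_succ] at hcost
    have hcost' := (ENat.add_le_add_iff_right ENat.one_ne_top).1 hcost
    obtain ⟨π, hπ, hπ0, hπL, hπtop, hfin, hcard⟩ := exists_pumped_play hρ hcons
      (fun k => hB _ (hmem k)) (lt_of_lt_of_le (by exact_mod_cast Nat.lt_succ_self _) hcost')
    refine ⟨π, hπ, hπ0.trans h0, hπL, hfin, by omega, fun y _ _ _ => ?_⟩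
    rw [← ho, hπtop]
    exact le_top
  | coe N =>
    have hNB : N ≤ B := by
      rcases hB x hx with h | h
      · rw [hc] at h
        exact absurd h (ENat.natCast_ne_top N)
      · rw [hc] at h
        exact_mod_cast h
    obtain ⟨ρ, hρ, h0, hcons, hcost⟩ := hL.valid.deter x hx x' hE N hc.ge
    obtain ⟨π, hπ, hπ0, hπL, hπcost, hfin, hcard⟩ := exists_truncated_play hρ hcons hcost
    refine ⟨π, hπ, hπ0.trans h0, hπL, hfin, hcard.trans (by gcongr; omega), fun y h1 h2 h3 => ?_⟩
    rw [ho] at hπcost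
    exact ((hmax y ⟨h1, h2, h3⟩).trans hc.le).trans hπcost

end ReachGame

theorem Arena.HasMemoryLE.mono {A : Arena P V} {v₀ : V} {σ : Profile P V} {M N : ℕ}
    (h : A.HasMemoryLE v₀ σ M) (hMN : M ≤ N) : A.HasMemoryLE v₀ σ N := by
  intro i
  obtain ⟨n, hn, S⟩ := h i
  exact ⟨n, hn.trans hMN, S⟩

theorem Arena.IsHistoryFrom.snd_subset {G : ReachGame P V} {x₀ x : V × Set P}
    {h : List (V × Set P)} (hh : G.extended.arena.IsHistoryFrom x₀ (h ++ [x])) :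
    ∀ z ∈ h, z.2 ⊆ x.2 := by
  induction h using List.reverseRecOn generalizing x with
  | nil => simp
  | append_singleton h y ih =>
    obtain ⟨hy, hE⟩ := hh.of_snoc
    have hyx := G.extended_edge_subset hE
    intro z hz
    rcases List.mem_append.1 hz with hz | hz
    · exact (ih hy z hz).trans hyx
    · rw [List.mem_singleton.1 hz]
      exact hyx

/-! ### From subgame perfect equilibria to valid bounds -/

namespace ReachGame

variable {G : ReachGame P V}

/-- In a subgame perfect equilibrium, moving to `x'` and following the profile afterwards does
not pay. -/
theorem reachCost_le_of_isSPE {x₀ : V × Set P} {σ : Profile P (V × Set P)}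
    (hσ : G.extended.toGame.IsSPE x₀ σ) {h : List (V × Set P)} {x x' : V × Set P}
    (hh : G.extended.arena.IsHistoryFrom x₀ (h ++ [x])) (hE : G.extended.arena.E x x') :
    G.extended.reachCost (G.arena.owner x.1) (G.extended.arena.outcome (σ.restrict h) x) ≤
      G.extended.reachCost (G.arena.owner x.1)
        (G.extended.arena.outcome (σ.restrict (h ++ [x])) x') + 1 := by
  classical
  set i := G.arena.owner x.1 with hi
  by_cases hix : i ∈ x.2
  · rw [(G.extended.reachCost_eq_zero_iff i).2 (by exact hix)]
    exact zero_le
  obtain ⟨hprof, hne⟩ := hσ h x hh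
  -- A one-shot deviation: move to `x'` now and follow `σ` afterwards.
  let s : Strategy (V × Set P) := fun h' v => if h' = [] then x' else σ.restrict h i h' v
  have hs : G.extended.arena.IsStrategy x i s := by
    intro h' v hh' hv
    simp only [s]
    split_ifs with hn
    · subst hn
      obtain rfl : v = x := by simpa using hh'.2
      exact hE
    · exact hprof i h' v hh' hv
  have hle : G.extended.reachCost i (prepend h (G.extended.arena.outcome (σ.restrict h) x)) ≤
      G.extended.reachCost i (prepend h
        (G.extended.arena.outcome (Function.update (σ.restrict h) i s) x)) := hne i s hs
  have hnot : ∀ z ∈ h, z ∉ G.extended.target i := fun z hz hz' => hix (hh.snd_subset z hz hz')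
  rw [G.extended.reachCost_prepend i hnot, G.extended.reachCost_prepend i hnot,
    ENat.add_le_add_iff_right (ENat.natCast_ne_top _)] at hle
  refine hle.trans ((G.extended.reachCost_le_shift i 1 _).trans (le_of_eq ?_))
  rw [Nat.cast_one]
  congr 2
  refine Arena.eq_outcome ?_ fun n => ?_
  · rw [shift_apply, Arena.outcome_succ]
    have : G.extended.arena.owner x = i := rfl
    simp [s, this]
  · rw [shift_apply, add_right_comm, Arena.outcome_succ, pref_succ_eq_cons, shift_apply]
    generalize G.extended.arena.owner _ = j
    by_cases hj : j = i
    · subst hj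
      simp [s, Profile.restrict]
    · simp [hj, Profile.restrict]

/-- The vertices reachable from `x₀`. -/
def reachable (G : ReachGame P V) (x₀ : V × Set P) : Set (V × Set P) :=
  {x | ∃ h, G.extended.arena.IsHistoryFrom x₀ (h ++ [x])}

theorem reachable_closed (x₀ : V × Set P) : ∀ x ∈ G.reachable x₀, ∀ x',
    G.extended.arena.E x x' → x' ∈ G.reachable x₀ := by
  rintro x ⟨h, hh⟩ x' hE
  exact ⟨h ++ [x], hh.snoc hE⟩

theorem mem_reachable_self (x₀ : V × Set P) : x₀ ∈ G.reachable x₀ :=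
  ⟨[], G.extended.arena.isHistoryFrom_singleton x₀⟩

/-- The largest cost that the owner of a vertex pays from there on, over all histories. -/
noncomputable def speBound (G : ReachGame P V) (x₀ : V × Set P) (σ : Profile P (V × Set P))
    (x : V × Set P) : ℕ∞ :=
  ⨆ h : {h // G.extended.arena.IsHistoryFrom x₀ (h ++ [x])},
    G.extended.reachCost (G.arena.owner x.1) (G.extended.arena.outcome (σ.restrict h.1) x)

/-- Each suffix of the outcome is itself the outcome after a longer history, which takes part in the
supremum. -/
theorem consistent_speBound {x₀ : V × Set P} {σ : Profile P (V × Set P)}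
    (hσ : G.extended.toGame.IsSPE x₀ σ) {h : List (V × Set P)} {x : V × Set P}
    (hh : G.extended.arena.IsHistoryFrom x₀ (h ++ [x])) :
    G.Consistent (G.speBound x₀ σ) (G.extended.arena.outcome (σ.restrict h) x) := by
  intro k
  have hplay : G.extended.arena.IsPlay (G.extended.arena.outcome (σ.restrict h) x) :=
    (hσ h x hh).1.isPlay_outcome
  rw [Arena.shift_outcome]
  exact le_iSup (fun h : {h // G.extended.arena.IsHistoryFrom x₀ (h ++ [_])} =>
    G.extended.reachCost _ (G.extended.arena.outcome (σ.restrict h.1) _))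
    ⟨_, hh.append_pref hplay rfl k⟩

/-- Some history ending in `x` makes the owner pay at least `N`. The continuation of the equilibrium
after that history and the move to `x'` is the required play. -/
theorem isValid_speBound {x₀ : V × Set P} {σ : Profile P (V × Set P)}
    (hσ : G.extended.toGame.IsSPE x₀ σ) : G.IsValid (G.reachable x₀) (G.speBound x₀ σ) := by
  refine ⟨fun x _ hi => ?_, fun x hx x' hE N hN => ?_⟩
  · rw [← le_zero_iff]
    refine iSup_le fun h => le_of_eq ?_
    exact (G.extended.reachCost_eq_zero_iff _).2 hi
  · obtain ⟨h, hh, hcost⟩ : ∃ h, G.extended.arena.IsHistoryFrom x₀ (h ++ [x]) ∧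
        N ≤ G.extended.reachCost (G.arena.owner x.1)
          (G.extended.arena.outcome (σ.restrict h) x) := by
      cases N with
      | zero =>
        obtain ⟨h, hh⟩ := hx
        exact ⟨h, hh, by simp⟩
      | succ N =>
        have hlt : (N : ℕ∞) < G.speBound x₀ σ x :=
          lt_of_lt_of_le (by exact_mod_cast Nat.lt_succ_self N) hN
        obtain ⟨h, hh⟩ := lt_iSup_iff.1 hlt
        refine ⟨h.1, h.2, ?_⟩
        rw [Nat.cast_succ]
        exact Order.add_one_le_of_lt hh
    have hh' := hh.snoc hE
    exact ⟨_, (hσ _ _ hh').1.isPlay_outcome, rfl, consistent_speBound hσ hh',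
      hcost.trans (reachCost_le_of_isSPE hσ hh hE)⟩

end ReachGame

/-! ### Subgame perfect equilibria with bounded memory -/

open ReachGame in
/-- Subgame perfect equilibria whose memory is bounded in terms of the largest finite bound. -/
theorem exists_simple_subgamePerfectEquilibrium [Fintype P] [Fintype V] (G : ReachGame P V)
    (v₀ : V) (σ : Profile P (V × Set P)) (y : P → ℕ∞)
    (hσ : G.extended.toGame.IsSPE (G.extendedInit v₀) σ)
    (hy : G.extended.toGame.costProfile (G.extendedInit v₀) σ ≤ y) {B : ℕ}
    (hB : (gapBound (Fintype.card P) (Fintype.card V))^[Fintype.card V * Fintype.card P] 0 = B) :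
    ∃ τ : Profile P (V × Set P),
      G.extended.toGame.IsSPE (G.extendedInit v₀) τ ∧
      G.extended.toGame.costProfile (G.extendedInit v₀) τ ≤ y ∧
      G.extended.arena.IsLassoOfLengthLE
        (G.extended.arena.outcome τ (G.extendedInit v₀))
        ((Fintype.card P + 1) * Fintype.card V) ∧
      (∀ i ∈ G.extended.visit (G.extended.arena.outcome τ (G.extendedInit v₀)),
        G.extended.toGame.costProfile (G.extendedInit v₀) τ i ≤
          ((Fintype.card P * Fintype.card V : ℕ) : ℕ∞)) ∧
      G.extended.arena.HasMemoryLE (G.extendedInit v₀) τ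
        ((Fintype.card P + 1) * Fintype.card V + 2 ^ Fintype.card P * Fintype.card P *
          Fintype.card V * (Fintype.card P * (B + Fintype.card V) + B +
            (Fintype.card P + 1) * Fintype.card V) + 1) := by
  classical
  set x₀ := G.extendedInit v₀ with hx₀
  set K := Fintype.card P * (B + Fintype.card V) + B +
    (Fintype.card P + 1) * Fintype.card V with hK
  have hP : 0 < Fintype.card P := Fintype.card_pos_iff.2 ⟨G.arena.owner v₀⟩
  obtain ⟨L, hle, hL⟩ := (isValid_speBound hσ).exists_isMinimalValid (reachable_closed x₀)
  have hBL := hL.bound hP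
  rw [hB] at hBL
  have hinit := G.extended.arena.isHistoryFrom_singleton x₀
  set ρ := G.extended.arena.outcome σ x₀ with hρdef
  have hρ : G.extended.arena.IsPlay ρ := (hσ [] x₀ hinit).1.isPlay_outcome
  have hρL : G.Consistent L ρ := (consistent_speBound (h := []) hσ hinit).mono hle
  obtain ⟨π, hπ, hπ0, hπcost, hπtail, hπfin, hπcard, hπbound⟩ := G.exists_short_lasso hρ
  have hπL : G.Consistent L π := hρL.of_tail hπtail
  replace hπ0 : π 0 = x₀ := hπ0
  have hdev : ∀ (x' : V × Set P) (i : P), ∃ π', G.extended.arena.IsPlay π' ∧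
      π' 0 ∈ G.reachable x₀ ∧ G.Consistent L π' ∧ (tails π').Finite ∧ (tails π').ncard ≤ K ∧
      ∀ x ∈ G.reachable x₀, G.extended.arena.E x x' → G.arena.owner x.1 = i →
        π' 0 = x' ∧ L x ≤ G.extended.reachCost i π' + 1 := by
    intro x' i
    by_cases hx : ∃ x ∈ G.reachable x₀, G.extended.arena.E x x' ∧ G.arena.owner x.1 = i
    · obtain ⟨π', h1, h2, h3, h4, h5, h6⟩ := hL.exists_punishment hBL hx
      refine ⟨π', h1, ?_, h3, h4, h5, fun x hx hE ho => ⟨h2, h6 x hx hE ho⟩⟩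
      obtain ⟨x, hx, hE, -⟩ := hx
      rw [h2]
      exact hL.closed x hx x' hE
    -- No deviation of `i` from a reachable vertex leads to `x'`, so `π` serves as a dummy value.
    · refine ⟨π, hπ, ?_, hπL, hπfin, by omega, fun x h1 h2 h3 => absurd ⟨x, h1, h2, h3⟩ hx⟩
      rw [hπ0]
      exact mem_reachable_self x₀
  choose pun hpun hpunR hpunL hpunfin hpuncard hpundev using hdev
  let T : (V × Set P) × P → Set (ℕ → V × Set P) := fun z => tails (pun z.1 z.2)
  let Q : Set (ℕ → V × Set P) := tails π ∪ ⋃ z, T z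
  have hQfin : Q.Finite := hπfin.union (Set.finite_iUnion fun z => hpunfin z.1 z.2)
  have hQcard : Q.ncard ≤ (Fintype.card P + 1) * Fintype.card V +
      2 ^ Fintype.card P * Fintype.card P * Fintype.card V * K := by
    refine (Set.ncard_union_le _ _).trans (add_le_add hπcard ?_)
    refine (Set.ncard_iUnion_le_of_fintype T).trans ((Finset.sum_le_card_nsmul _ _ K fun z _ => hpuncard z.1 z.2).trans ?_)
    rw [Finset.card_univ, Fintype.card_prod, Fintype.card_prod, Fintype.card_set, smul_eq_mul]
    exact le_of_eq (by ring)
  have hQshift : ∀ q ∈ Q, shift 1 q ∈ Q := by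
    rintro q (hq | hq)
    · exact Or.inl (shift_one_mem_tails hq)
    · obtain ⟨z, hz⟩ := Set.mem_iUnion.1 hq
      exact Or.inr (Set.mem_iUnion.2 ⟨z, shift_one_mem_tails hz⟩)
  have hQprop : ∀ q ∈ Q, G.extended.arena.IsPlay q ∧ q 0 ∈ G.reachable x₀ ∧
      G.Consistent L q := by
    have key : ∀ τ, G.extended.arena.IsPlay τ → τ 0 ∈ G.reachable x₀ → G.Consistent L τ →
        ∀ q ∈ tails τ, G.extended.arena.IsPlay q ∧ q 0 ∈ G.reachable x₀ ∧
          G.Consistent L q := by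
      rintro τ h1 h2 h3 _ ⟨k, rfl⟩
      exact ⟨h1.shift k, mem_of_isPlay hL.closed h1 h2 _, h3.shift k⟩
    rintro q (hq | hq)
    · exact key π hπ (by rw [hπ0]; exact mem_reachable_self x₀) hπL q hq
    · obtain ⟨z, hz⟩ := Set.mem_iUnion.1 hq
      exact key _ (hpun z.1 z.2) (hpunR z.1 z.2) (hpunL z.1 z.2) q hz
  have : Fintype Q := hQfin.fintype
  let M : Automaton G.extended.arena Q :=
    { vert := fun q => q.1 0
      step := fun q => ⟨shift 1 q.1, hQshift _ q.2⟩
      dev := fun x' i => ⟨pun x' i, Or.inr (Set.mem_iUnion.2 ⟨(x', i), self_mem_tails _⟩)⟩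
      edge := fun q => (hQprop q.1 q.2).1 0
      vert_dev := fun q v hE => (hpundev v _ _ (hQprop q.1 q.2).2.1 hE rfl).1 }
  let q₀ : Q := ⟨π, Or.inl (self_mem_tails π)⟩
  have hq₀ : M.vert q₀ = x₀ := hπ0
  have hplay : ∀ q : Q, M.play q = q.1 := by
    intro q
    have : ∀ k, (M.step^[k] q).1 = shift k q.1 := by
      intro k
      induction k with
      | zero => rfl
      | succ k ih =>
        rw [Function.iterate_succ_apply']
        change shift 1 (M.step^[k] q).1 = _
        rw [ih, shift_shift, add_comm]
    funext k
    change (M.step^[k] q).1 0 = _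
    rw [this, shift_apply, zero_add]
  have hout : G.extended.arena.outcome (M.profile q₀) x₀ = π := by
    rw [← hq₀, M.outcome_profile, hplay]
  have hprof : ∀ i, G.extended.toGame.costProfile x₀ (M.profile q₀) i =
      G.extended.reachCost i π := by
    intro i
    rw [← hout]
    rfl
  refine ⟨M.profile q₀, fun h v hh => ⟨?_, fun i s hs => ?_⟩, fun i => ?_, ?_, fun i hi => ?_, ?_⟩
  · have := M.isProfile_profile q₀
    rw [hq₀] at this
    exact this.restrict hh
  · rw [← hq₀] at hh
    refine G.extended.reachCost_prepend_mono i h ?_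
    -- The potential of a state is the cost for `i` of its play. When `i` deviates from `x`,
    -- consistency bounds it by `L x`, and the punishment costs at least `L x - 1`.
    have hdev := M.le_reachCost_deviation G.extended rfl hh i (S := Set.univ)
      (c := fun q => G.extended.reachCost i q.1) (Set.mem_univ _)
      (fun q _ => ⟨Set.mem_univ _, G.extended.reachCost_le_shift i 1 q.1⟩)
      (fun q _ ho u hE => ⟨Set.mem_univ _, ?_⟩)
      (fun q _ ht => (G.extended.reachCost_eq_zero_iff i).2 ht) hs
    · refine le_trans (le_of_eq ?_) hdev
      rw [← hplay, ← M.outcome_restrict_profile hh]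
      rfl
    · obtain ⟨-, h2, h3⟩ := hQprop q.1 q.2
      have h4 := h3 0
      rw [shift_zero] at h4
      have ho' : G.arena.owner (q.1 0).1 = i := ho
      rw [ho'] at h4
      exact h4.trans (hpundev u i _ h2 hE ho').2
  · rw [hprof]
    exact (hπcost i).trans (hy i)
  · rw [hout]
    exact G.extended.arena.isLassoOfLengthLE_of_tails hπ hπfin hπcard
  · rw [hprof]
    refine hπbound i ?_
    rw [hout] at hi
    exact reachCost_ne_top_of_mem_visit hi
  · refine M.hasMemoryLE_profile x₀ q₀ (Nat.add_le_add_right ?_ 1)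
    rw [← Nat.card_eq_fintype_card]
    exact hQcard

/-! ### Arithmetic of the memory bound -/

/-- Raise `n ≤ m ^ (n / m + 1)` to the power `m`. This trades the base `n`, produced by the gap
recursion, for the base `m`. -/
theorem pow_le_pow_add {m : ℕ} (hm : 2 ≤ m) (n : ℕ) : n ^ m ≤ m ^ (n + m) := by
  have h1 : n ≤ m ^ (n / m + 1) := by
    calc n ≤ m * (n / m + 1) := (Nat.lt_mul_div_succ n (by omega)).le
      _ ≤ m * m ^ (n / m) := Nat.mul_le_mul_left _ (Nat.lt_pow_self hm)
      _ = m ^ (n / m + 1) := by ring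
  calc n ^ m ≤ (m ^ (n / m + 1)) ^ m := Nat.pow_le_pow_left h1 m
    _ = m ^ (n / m * m + m) := by rw [← pow_mul]; congr 1; ring
    _ ≤ m ^ (n + m) := Nat.pow_le_pow_right (by omega) (by
      have := Nat.div_mul_le_self n m
      omega)

theorem iterate_gapBound_le {n : ℕ} (hn : 0 < n) (m r : ℕ) :
    (gapBound n m)^[r] 0 ≤ r * (n * m + 1) * n ^ r := by
  induction r with
  | zero => simp
  | succ r ih =>
    rw [Function.iterate_succ_apply', gapBound]
    have h1 : 1 ≤ n ^ (r + 1) := Nat.one_le_pow _ _ hn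
    calc n * ((gapBound n m)^[r] 0 + m) + 1
        ≤ n * (r * (n * m + 1) * n ^ r + m) + 1 := by gcongr
      _ = r * (n * m + 1) * n ^ (r + 1) + (n * m + 1) * 1 := by ring
      _ ≤ r * (n * m + 1) * n ^ (r + 1) + (n * m + 1) * n ^ (r + 1) := by gcongr
      _ = (r + 1) * (n * m + 1) * n ^ (r + 1) := by ring

theorem cube_le_four_mul_two_pow (n : ℕ) : n ^ 3 ≤ 4 * 2 ^ n := by
  by_cases hn : n < 4
  · interval_cases n <;> norm_num
  · induction n, not_lt.1 hn using Nat.le_induction with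
    | base => norm_num
    | succ n h ih =>
      have := ih (by omega)
      rw [pow_succ 2]
      nlinarith [Nat.mul_le_mul h (Nat.mul_le_mul h h), Nat.mul_le_mul h h,
        Nat.mul_le_mul_right (n * n) h]

/-- With `e = m ^ ((n + m) * n)` one has `B ≤ 2 * (n * m) ^ 2 * e`, so a punishment needs at most `7
* n ^ 3 * m ^ 2 * e` states. The polynomial factor is absorbed by `4 * m ^ (n + m)`, giving `28`.
The outcome and the initial memory state add `3`. -/
theorem memory_bound {n m : ℕ} (hn : 0 < n) (hm : 2 ≤ m) :
    (n + 1) * m + 2 ^ n * n * m * (n * ((gapBound n m)^[m * n] 0 + m) +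
      (gapBound n m)^[m * n] 0 + (n + 1) * m) + 1 ≤
      31 * (2 ^ n * n * m ^ ((n + 1) * (n + m) + 1)) := by
  have hB := iterate_gapBound_le hn m (m * n)
  set B := (gapBound n m)^[m * n] 0
  set e := m ^ ((n + m) * n) with he
  have he1 : 1 ≤ e := Nat.one_le_pow _ _ (by omega)
  have hne : n ^ (m * n) ≤ e := by
    rw [pow_mul, he, pow_mul]
    exact Nat.pow_le_pow_left (pow_le_pow_add hm n) n
  have hnm : 1 ≤ n * m := Nat.mul_pos hn (by omega)
  have hB' : B ≤ 2 * (n * m) ^ 2 * e := by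
    calc B ≤ m * n * (n * m + 1) * n ^ (m * n) := hB
      _ ≤ m * n * (n * m + n * m) * e := by gcongr
      _ = 2 * (n * m) ^ 2 * e := by ring
  have hpow : n ^ 3 * m ^ 2 ≤ 4 * m ^ (n + m) := by
    calc n ^ 3 * m ^ 2 ≤ 4 * 2 ^ n * m ^ m :=
          Nat.mul_le_mul (cube_le_four_mul_two_pow n) (Nat.pow_le_pow_right (by omega) hm)
      _ ≤ 4 * m ^ n * m ^ m := by gcongr
      _ = 4 * m ^ (n + m) := by ring
  have hK : n * (B + m) + B + (n + 1) * m ≤ 28 * (e * m ^ (n + m)) := by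
    have h1 : n * m ≤ n ^ 3 * m ^ 2 * e := by
      calc n * m = n * m * 1 * 1 := by ring
        _ ≤ n * m * (n * (n * m)) * e := by
            gcongr
            exact Nat.mul_pos hn hnm
        _ = n ^ 3 * m ^ 2 * e := by ring
    calc n * (B + m) + B + (n + 1) * m = n * B + 1 * B + (2 * (n * m) + 1 * m) := by ring
      _ ≤ n * B + n * B + (2 * (n * m) + n * m) := by gcongr <;> omega
      _ = 2 * n * B + 3 * (n * m) := by ring
      _ ≤ 2 * n * (2 * (n * m) ^ 2 * e) + 3 * (n ^ 3 * m ^ 2 * e) := by gcongr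
      _ = 7 * (n ^ 3 * m ^ 2) * e := by ring
      _ ≤ 7 * (4 * m ^ (n + m)) * e := by gcongr
      _ = 28 * (e * m ^ (n + m)) := by ring
  have hfac : m ^ ((n + 1) * (n + m) + 1) = m * (e * m ^ (n + m)) := by
    rw [he, ← pow_add, ← pow_succ']
    congr 1
    ring
  rw [hfac]
  set F := e * m ^ (n + m)
  have hF : 1 ≤ F := Nat.mul_pos he1 (Nat.one_le_pow _ _ (by omega))
  have hsmall : n * m ≤ 2 ^ n * n * (m * F) := by
    calc n * m = 1 * n * (m * 1) := by ring
      _ ≤ 2 ^ n * n * (m * F) := by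
        gcongr
        exact Nat.one_le_two_pow
  calc (n + 1) * m + 2 ^ n * n * m * (n * (B + m) + B + (n + 1) * m) + 1
      ≤ (n + n) * m + 2 ^ n * n * m * (28 * F) + n * m := by gcongr; omega
    _ = 3 * (n * m) + 28 * (2 ^ n * n * (m * F)) := by ring
    _ ≤ 3 * (2 ^ n * n * (m * F)) + 28 * (2 ^ n * n * (m * F)) := by gcongr
    _ = 31 * (2 ^ n * n * (m * F)) := by ring

/-! ### Games with a single vertex -/

section

variable [Subsingleton V] {G : ReachGame P V} {v₀ : V}

namespace ReachGame

theorem edge_extendedInit_iff {x : V × Set P} :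
    G.extended.arena.E (G.extendedInit v₀) x ↔ x = G.extendedInit v₀ := by
  constructor
  · rintro ⟨-, h⟩
    refine Prod.ext (Subsingleton.elim _ _) ?_
    rw [h, Subsingleton.elim x.1 v₀]
    exact Set.union_self _
  · rintro rfl
    obtain ⟨v, hv⟩ := G.arena.exists_succ v₀
    rw [Subsingleton.elim v v₀] at hv
    exact ⟨hv, (Set.union_self _).symm⟩

theorem eq_const_of_isPlay {ρ : ℕ → V × Set P} (hρ : G.extended.arena.IsPlay ρ)
    (h0 : ρ 0 = G.extendedInit v₀) : ρ = fun _ => G.extendedInit v₀ := by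
  funext k
  induction k with
  | zero => exact h0
  | succ k ih =>
    have := hρ k
    rw [ih] at this
    exact edge_extendedInit_iff.1 this

theorem eq_extendedInit_of_isHistoryFrom {h : List (V × Set P)} {x : V × Set P}
    (hh : G.extended.arena.IsHistoryFrom (G.extendedInit v₀) (h ++ [x])) :
    x = G.extendedInit v₀ := by
  induction h using List.reverseRecOn generalizing x with
  | nil => simpa using hh.2
  | append_singleton h y ih =>
    obtain ⟨hy, hE⟩ := hh.of_snoc
    rw [ih hy] at hE
    exact edge_extendedInit_iff.1 hE

end ReachGame

open ReachGame in
/-- With a single vertex, all plays of the extended game coincide. -/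
theorem exists_subgamePerfectEquilibrium_of_subsingleton [Fintype P] [Fintype V]
    (σ : Profile P (V × Set P)) (y : P → ℕ∞)
    (hσ : G.extended.toGame.IsSPE (G.extendedInit v₀) σ)
    (hy : G.extended.toGame.costProfile (G.extendedInit v₀) σ ≤ y) :
    ∃ τ : Profile P (V × Set P),
      G.extended.toGame.IsSPE (G.extendedInit v₀) τ ∧
      G.extended.toGame.costProfile (G.extendedInit v₀) τ ≤ y ∧
      G.extended.arena.IsLassoOfLengthLE
        (G.extended.arena.outcome τ (G.extendedInit v₀))
        ((Fintype.card P + 1) * Fintype.card V) ∧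
      (∀ i ∈ G.extended.visit (G.extended.arena.outcome τ (G.extendedInit v₀)),
        G.extended.toGame.costProfile (G.extendedInit v₀) τ i ≤
          ((Fintype.card P * Fintype.card V : ℕ) : ℕ∞)) ∧
      G.extended.arena.HasMemoryLE (G.extendedInit v₀) τ 1 := by
  classical
  have hout : ∀ τ : Profile P (V × Set P), G.extended.arena.IsProfile (G.extendedInit v₀) τ →
      G.extended.arena.outcome τ (G.extendedInit v₀) = fun _ => G.extendedInit v₀ :=
    fun τ hτ => eq_const_of_isPlay hτ.isPlay_outcome rfl
  have hinit := G.extended.arena.isHistoryFrom_singleton (G.extendedInit v₀)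
  have hσout := hout σ (hσ [] _ hinit).1
  let τ : Profile P (V × Set P) := fun _ _ _ => G.extendedInit v₀
  have hτ : G.extended.arena.IsProfile (G.extendedInit v₀) τ := by
    intro i h x hh _
    rw [eq_extendedInit_of_isHistoryFrom hh]
    exact edge_extendedInit_iff.2 rfl
  have hτout := hout τ hτ
  have hplay := hτ.isPlay_outcome
  have htails : tails (fun _ => G.extendedInit v₀ : ℕ → V × Set P) ⊆
      {fun _ => G.extendedInit v₀} := by
    rintro _ ⟨k, rfl⟩
    rfl
  refine ⟨τ, fun h x hh => ?_, fun i => ?_, ?_, fun i hi => ?_, ?_⟩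
  · obtain rfl := eq_extendedInit_of_isHistoryFrom hh
    have hr : G.extended.arena.IsProfile (G.extendedInit v₀) (τ.restrict h) := hτ.restrict hh
    refine ⟨hr, fun i s hs => le_of_eq ?_⟩
    have h1 := hout _ hr
    have h2 := hout _ (hr.update hs)
    change G.extended.reachCost i (prepend h (G.extended.arena.outcome _ _)) =
      G.extended.reachCost i (prepend h (G.extended.arena.outcome _ _))
    rw [h1, h2]
  · refine le_trans (le_of_eq ?_) (hy i)
    change G.extended.reachCost i (G.extended.arena.outcome _ _) =
      G.extended.reachCost i (G.extended.arena.outcome _ _)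
    rw [hτout, hσout]
  · rw [hτout] at hplay ⊢
    refine G.extended.arena.isLassoOfLengthLE_of_tails hplay
      ((Set.finite_singleton _).subset htails) ?_
    refine (Set.ncard_le_ncard htails (Set.finite_singleton _)).trans ?_
    rw [Set.ncard_singleton]
    exact Nat.mul_pos (Nat.succ_pos _) (Fintype.card_pos_iff.2 ⟨v₀⟩)
  · obtain ⟨k, hk⟩ := hi
    rw [hτout] at hk
    change G.extended.reachCost i (G.extended.arena.outcome _ _) ≤ _
    rw [hτout, (G.extended.reachCost_eq_zero_iff i).2 hk]
    exact zero_le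
  · exact G.extended.arena.hasMemoryLE_of_fintype (S := Unit) _ () (fun _ _ => ())
      (fun _ _ => G.extendedInit v₀) (by simp)

end

end ReachabilityGames

theorem mainTheorem8 :
    (∃ C : ℕ, ∀ (P : Type u) (V : Type w) [Fintype P] [Fintype V]
        (G : ReachabilityGames.ReachGame P V) (v₀ : V)
        (σ : ReachabilityGames.Profile P V) (y : P → ℕ∞),
        G.toGame.IsNE v₀ σ →
        G.toGame.costProfile v₀ σ ≤ y →
        ∃ τ : ReachabilityGames.Profile P V,
          G.toGame.IsNE v₀ τ ∧
          G.toGame.costProfile v₀ τ ≤ y ∧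
          G.arena.IsLassoOfLengthLE (G.arena.outcome τ v₀)
            ((Fintype.card P + 1) * Fintype.card V) ∧
          (∀ i ∈ G.visit (G.arena.outcome τ v₀),
            G.toGame.costProfile v₀ τ i ≤ ((Fintype.card P * Fintype.card V : ℕ) : ℕ∞)) ∧
          G.arena.HasMemoryLE v₀ τ (C * ((Fintype.card P + 1) * Fintype.card V))) ∧
    (∃ C : ℕ, ∀ (P : Type u) (V : Type w) [Fintype P] [Fintype V]
        (G : ReachabilityGames.ReachGame P V) (v₀ : V)
        (σ : ReachabilityGames.Profile P (V × Set P)) (y : P → ℕ∞),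
        G.extended.toGame.IsSPE (G.extendedInit v₀) σ →
        G.extended.toGame.costProfile (G.extendedInit v₀) σ ≤ y →
        ∃ τ : ReachabilityGames.Profile P (V × Set P),
          G.extended.toGame.IsSPE (G.extendedInit v₀) τ ∧
          G.extended.toGame.costProfile (G.extendedInit v₀) τ ≤ y ∧
          G.extended.arena.IsLassoOfLengthLE
            (G.extended.arena.outcome τ (G.extendedInit v₀))
            ((Fintype.card P + 1) * Fintype.card V) ∧
          (∀ i ∈ G.extended.visit (G.extended.arena.outcome τ (G.extendedInit v₀)),
            G.extended.toGame.costProfile (G.extendedInit v₀) τ i ≤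
              ((Fintype.card P * Fintype.card V : ℕ) : ℕ∞)) ∧
          G.extended.arena.HasMemoryLE (G.extendedInit v₀) τ
            (C * (2 ^ Fintype.card P * Fintype.card P *
              Fintype.card V ^
                ((Fintype.card P + 1) * (Fintype.card P + Fintype.card V) + 1)))) := by
  refine ⟨⟨3, fun P V _ _ G v₀ σ y hσ hy =>
    ReachabilityGames.exists_simple_nashEquilibrium G v₀ σ y hσ hy⟩,
    ⟨31, fun P V _ _ G v₀ σ y hσ hy => ?_⟩⟩
  have hP : 0 < Fintype.card P := Fintype.card_pos_iff.2 ⟨G.arena.owner v₀⟩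
  have hV : 0 < Fintype.card V := Fintype.card_pos_iff.2 ⟨v₀⟩
  -- For one vertex the power of `|V|` in the bound is `1`, and `pow_le_pow_add` is not available.
  -- There the extended game has a single play and one memory state suffices.
  by_cases hm : 2 ≤ Fintype.card V
  · obtain ⟨τ, h1, h2, h3, h4, h5⟩ :=
      ReachabilityGames.exists_simple_subgamePerfectEquilibrium G v₀ σ y hσ hy rfl
    exact ⟨τ, h1, h2, h3, h4, h5.mono (ReachabilityGames.memory_bound hP hm)⟩
  · have : Subsingleton V := Fintype.card_le_one_iff_subsingleton.1 (by omega)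
    obtain ⟨τ, h1, h2, h3, h4, h5⟩ :=
      ReachabilityGames.exists_subgamePerfectEquilibrium_of_subsingleton σ y hσ hy
    refine ⟨τ, h1, h2, h3, h4, h5.mono ?_⟩
    exact Nat.mul_pos (by norm_num) (Nat.mul_pos (Nat.mul_pos (by positivity) hP) (pow_pos hV _))
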